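/- \textbf{Theorem (CIU coincides with the logical relations).} For all redexes $r_1,r_2$ of sequential Core Erlang and all scopes (sets of names) $\Gamma$, $$r_1\le_{ciu}^{\Gamma} r_2\iff (r_1,r_2)\in\mathbb R^{\Gamma}.$$ The notions are the following. \emph{Syntax.} Names are variables $x$ and function identifiers $f/k$ ($f$ an atom, $k\in\mathbb N$). Patterns are $p::=i\mid a\mid x\mid[p|p]\mid[]\mid\{p,\dots,p\}\mid\sim\!\{p\Rightarrow p,\dots\}\!\sim$ with integers $i$ and atoms $a$. A list $ext$ of function definitions consists of items $f/k=\mathtt{fun}(x_1,\dots,x_k)\to e$. Values are $v::=i\mid a\mid x\mid f/k\mid clos(ext,[x_1,\dots,x_n],e)\mid[v|v]\mid[]\mid\{v,\dots,v\}\mid\sim\!\{v\Rightarrow v,\dots\}\!\sim$. Expressions are the values, $\mathtt{fun}(x_1,\dots,x_n)\to e$, value lists $<e_1,\dots,e_n>$, lists $[e|e]$, tuples, maps, $\mathtt{call}\ e_m{:}e_f(e_1,\dots,e_n)$, $\mathtt{primop}\ a(e_1,\dots,e_n)$, $\mathtt{apply}\ e(e_1,\dots,e_n)$, $\mathtt{case}\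 e\ \mathtt{of}\ cl_1;\dots;cl_n\ \mathtt{end}$ with clauses $cl=ps\ \mathtt{when}\ e^g\to e^b$ ($ps$ a list of patterns), $\mathtt{let}<x_1,\dots,x_n>=e_1\ \mathtt{in}\ e_2$, $\mathtt{do}\ e_1\ e_2$, $\mathtt{letrec}\ ext\ \mathtt{in}\ e$, and $\mathtt{try}\ e_1\ \mathtt{of}<\vec x>\to e_2\ \mathtt{catch}<\vec y>\to e_3$. Redexes are the value sequences $<v_1,\dots,v_n>$, the exceptions $\{c,v_r,v_d\}^X$ (class $c$ one of throw, exit, error), the expressions, and $\Box$; results are the value sequences and the exceptions. \emph{Scopes.} $\Gamma\vdash r$ means that all free names of $r$ lie in $\Gamma$; $r$ is closed if $\emptyset\vdash r$. A closing substitution $\Gamma\vdash\sigma\multimap\emptyset$ maps the names in $\Gamma$, and no others, to closed values; $r[\sigma]$ is the substituted redex. For $ext$, $\mathrm{mk}(ext)$ is the substitution that maps each $f/k$ defined by $f/k=\mathtt{fun}(x_1,\dots,x_k)\to e$ in $ext$ to $clos(ext,[x_1,\dots,x_k],e)$. \emph{Frames.} Frame stacks $K$ are finite lists ($\varepsilon$,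 or $F::K$) of frames: $id(v_1,\dots,v_{i-1},\Box,e_{i+1},\dots,e_n)$ with $id$ one of $tuple$, $values$, $map$, $call(v_m,v_f)$, $primop(a)$, $app(v_f)$; $[e_1|\Box]$; $[\Box|v_2]$; $\mathtt{call}\ \Box{:}e_f(\vec e)$; $\mathtt{call}\ v_m{:}\Box(\vec e)$; $\mathtt{apply}\ \Box(\vec e)$; $\mathtt{case}\ \Box\ \mathtt{of}\ \vec{cl}\ \mathtt{end}$; $\mathtt{case}\ vs\ \mathtt{of}\ ps\ \mathtt{when}\ \Box\to e^b;\vec{cl}\ \mathtt{end}$ (the variables of $ps$ already substituted in $e^b$); $\mathtt{let}<\vec x>=\Box\ \mathtt{in}\ e_2$; $\mathtt{do}\ \Box\ e_2$; $\mathtt{try}\ \Box\ \mathtt{of}<\vec x>\to e_2\ \mathtt{catch}<\vec y>\to e_3$. A frame is closed if filling $\Box$ with a closed expression gives a closed expression (a $map$ frame therefore has an odd number of subvalues and subexpressions); a stack is closed if all its frames are. \emph{Steps} $\langle K,r\rangle\to\langle K',r'\rangle$. (1) An expression pushes its frame and continues with its first subexpression: $[e_1|e_2]$ with $e_2$ (frame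 $[e_1|\Box]$), a nonempty map with its first key (frame $map(\Box,\dots)$ with the remaining values and keys in order), $\mathtt{let},\mathtt{do},\mathtt{apply},\mathtt{call},\mathtt{case},\mathtt{try}$ with their head; $\mathtt{primop}$, value lists and tuples push $id(\Box,e_1,\dots,e_n)$ and continue with $\Box$. (2) $[e_1|\Box]$ with $<v_2>$ becomes $[\Box|v_2]$ with $e_1$; $\mathtt{call}\ \Box{:}e_f(\vec e)$ with $<v_m>$ becomes $\mathtt{call}\ v_m{:}\Box(\vec e)$ with $e_f$; the latter with $<v_f>$ becomes $call(v_m,v_f)(\Box,\vec e)$ with $\Box$; $\mathtt{apply}\ \Box(\vec e)$ with $<v>$ becomes $app(v)(\Box,\vec e)$ with $\Box$; $id(\Box,e_1,\vec e)$ with $\Box$, $id\ne map$, becomes $id(\Box,\vec e)$ with $e_1$; $id(\vec v,\Box,e,\vec e)$ with $<v>$ becomes $id(\vec v,v,\Box,\vec e)$ with $e$; a $\mathtt{case}\ \Box$ frame with $vs$ drops its first clause if its patterns do not match $vs$ pairwise, and otherwise becomes its guard frame with redex $e^g$, the matched bindings being substituted in $e^g$ and $e^b$; the guard frame with $<\text{'false'}>$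 becomes $\mathtt{case}\ \Box$ with the remaining clauses and redex $vs$. (3) The empty map expression becomes $<\sim\!\{\}\!\sim>$; $\mathtt{fun}(\vec x)\to e$ becomes $<clos(\emptyset,[\vec x],e)>$; $\mathtt{letrec}\ ext\ \mathtt{in}\ e$ becomes $e[\mathrm{mk}(ext)]$; a value expression $v$ becomes $<v>$; $id(\vec v,\Box)$ with $\Box$ ($id\ne map$) or with $<v>$ is popped, giving $eval(id,\vec v)$ or $eval(id,(\vec v,v))$; $[\Box|v_2]$ with $<v_1>$ gives $<[v_1|v_2]>$; the guard frame with $<\text{'true'}>$ gives $e^b$; the $\mathtt{let}$ and $\mathtt{try}$ frames with $<v_1,\dots,v_n>$, $n=|\vec x|$, give $e_2[\vec x\mapsto\vec v]$; $\mathtt{do}\ \Box\ e_2$ with $<v>$ gives $e_2$. (4) $\mathtt{case}\ \Box$ without clauses, with a value sequence, gives $\{error,if\_clause,\{\}\}^X$; a $\mathtt{try}$ frame with $\vec y=y_1,y_2,y_3$ and the exception $\{c,v_r,v_d\}^X$ gives $e_3[y_1\mapsto c,y_2\mapsto v_r,y_3\mapsto v_d]$; an exception removes any frame that is not a $\mathtt{try}$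 frame. \emph{Results of parameter lists.} $eval(tuple,\vec v)=<\{\vec v\}>$; $eval(values,\vec v)=<\vec v>$; $eval(map,v_1,\dots,v_{2k})$ is the map with the associations $v_{2j-1}\Rightarrow v_{2j}$, ordered by keys and with the last of several associations with equal keys; for an odd number of values it is undefined. $eval(app(clos(ext,[x_1,\dots,x_n],e)),v_1,\dots,v_n)=e[\mathrm{mk}(ext),x_1\mapsto v_1,\dots,x_n\mapsto v_n]$; with a wrong number of parameters the result is the error exception badarity, and for $app(v)$ with $v$ not a closure it is badfun. $eval(primop(\text{'match\_fail'}),v)=\{error,v,\{\}\}^X$. $eval(call(\text{'erlang'},f),\vec v)$ is the Erlang behaviour (badarith or badarg exceptions included) of: $+,-,*$, div, rem, bsl, bsr, abs; and, or, xor, not; $==$, $=:=$, $/=$, $=/=$, $<$, $=<$, $>$, $>=$; $++$, $--$, length, hd, tl, tuple\_size, element, setelement, tuple\_to\_list, list\_to\_tuple; is\_integer, is\_number, is\_atom, is\_boolean, is\_function, is\_list, is\_tuple, is\_map; fun\_info (arity); error, exit, throw, raise. Terms are ordered in Erlang's term order (numbers, atoms, functions, tuples, maps, $[]$, nonempty lists),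 and closures are compared by their arity only. Any other call or primop gives the error exception undef, and a call whose module or function is not an atom gives badarg. \emph{Termination.} $\langle K,r\rangle\Downarrow^n$ means $\langle K,r\rangle\to^n\langle\varepsilon,res\rangle$ for some result $res$, and $\langle K,r\rangle\Downarrow$ that this holds for some $n$. \emph{CIU.} $r_1\le_{ciu}r_2$ means: $r_1,r_2$ are closed and for every closed $K$, $\langle K,r_1\rangle\Downarrow$ implies $\langle K,r_2\rangle\Downarrow$. $r_1\le^\Gamma_{ciu}r_2$ means $r_1[\sigma]\le_{ciu}r_2[\sigma]$ for all $\Gamma\vdash\sigma\multimap\emptyset$. \emph{Logical relations}, on closed objects, by recursion on $n\in\mathbb N$. $(r_1,r_2)\in\mathbb R_n$ iff for all $m\le n$ and $(K_1,K_2)\in\mathbb K_m$, $\langle K_1,r_1\rangle\Downarrow^m$ implies $\langle K_2,r_2\rangle\Downarrow$; $\mathbb E_n$ is $\mathbb R_n$ on expressions. $(K_1,K_2)\in\mathbb K_n$ iff for all $m\le n$: $\langle K_1,r\rangle\Downarrow^m$ implies $\langle K_2,r'\rangle\Downarrow$ whenever $r,r'$ are value sequences of the same length with entries pairwise in $\mathbb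 V_m$, or exceptions of the same class with reasons and details pairwise in $\mathbb V_m$, or $r=r'=\Box$. $\mathbb V_n$ relates equal integers, equal atoms, $[]$ with $[]$; lists, tuples and maps elementwise; and closures $clos(ext,[x_1,\dots,x_k],e)$, $clos(ext',[x_1',\dots,x_k'],e')$ of the same arity such that for all $m<n$ and $(v_1,v_1'),\dots,(v_k,v_k')\in\mathbb V_m$, $(e[\mathrm{mk}(ext),\vec x\mapsto\vec v],\,e'[\mathrm{mk}(ext'),\vec x'\mapsto\vec v'])\in\mathbb E_m$. Finally $(r_1,r_2)\in\mathbb R^\Gamma$ iff $(r_1[\sigma_1],r_2[\sigma_2])\in\mathbb R_n$ for all $n$ and all closing substitutions $\sigma_1,\sigma_2$ of $\Gamma$ with $(\sigma_1(x),\sigma_2(x))\in\mathbb V_n$ for every $x\in\Gamma$. -/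

import Mathlib

namespace CoreErlang

/-! ## Syntax -/

/-- Variables. -/
abbrev Var := String

/-- Atoms. -/
abbrev Atom := String

/-- Names: variables `x` and function identifiers `f/k`. -/
inductive Name : Type
  | var (x : Var)
  | fid (f : Atom) (k : ℕ)
  deriving DecidableEq

/-- Patterns. -/
inductive Pat : Type
  | int (i : ℤ)
  | atom (a : Atom)
  | var (x : Var)
  | cons (p q : Pat)
  | nil
  | tuple (ps : List Pat)
  | map (ps : List (Pat × Pat))

mutual

/-- Values. A variable and a function identifier are (open) values; `clos ext xs e` is the closure
of `fun (xs) -> e` with the recursive definitions `ext`. -/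
inductive Val : Type
  | int (i : ℤ)
  | atom (a : Atom)
  | var (x : Var)
  | fid (f : Atom) (k : ℕ)
  | clos (ext : List ClosItem) (xs : List Var) (e : Exp)
  | cons (v w : Val)
  | nil
  | tuple (vs : List Val)
  | map (vs : List (Val × Val))

/-- Expressions: values, and the non-values. -/
inductive Exp : Type
  | val (v : Val)
  /-- `fun (xs) -> e` -/
  | lam (xs : List Var) (e : Exp)
  /-- `<e₁, ..., eₙ>` -/
  | values (es : List Exp)
  /-- `[e₁ | e₂]` -/
  | cons (e₁ e₂ : Exp)
  /-- `{e₁, ..., eₙ}` -/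
  | tuple (es : List Exp)
  /-- `~{e₁ᵏ => e₁ᵛ, ...}~` -/
  | map (es : List (Exp × Exp))
  /-- `call em:ef(e₁, ..., eₙ)` -/
  | call (em ef : Exp) (es : List Exp)
  /-- `primop a(e₁, ..., eₙ)` -/
  | primop (a : Atom) (es : List Exp)
  /-- `apply e(e₁, ..., eₙ)` -/
  | app (e : Exp) (es : List Exp)
  /-- `case e of cl₁; ...; clₙ end` -/
  | case (e : Exp) (cls : List Clause)
  /-- `let <xs> = e₁ in e₂` -/
  | elet (xs : List Var) (e₁ e₂ : Exp)
  /-- `do e₁ e₂` -/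
  | seq (e₁ e₂ : Exp)
  /-- `letrec ext in e` -/
  | letrec (ext : List ClosItem) (e : Exp)
  /-- `try e₁ of <xs> -> e₂ catch <ys> -> e₃` -/
  | etry (e₁ : Exp) (xs : List Var) (e₂ : Exp) (ys : List Var) (e₃ : Exp)

/-- A function definition `f/k = fun (x₁, ..., xₖ) -> e`; the arity `k` is the length of `xs`. -/
inductive ClosItem : Type
  | mk (f : Atom) (xs : List Var) (e : Exp)

/-- A clause `ps when eg -> eb`. -/
inductive Clause : Type
  | mk (ps : List Pat) (eg eb : Exp)

end

/-- Exception classes. -/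
inductive ExcClass : Type
  | throw | exit | error

/-- Exceptions `{c, vr, vd}ˣ`: class, reason, details. -/
structure Exc : Type where
  cls : ExcClass
  reason : Val
  details : Val

/-- Redexes: value sequences, exceptions, expressions and `□`. -/
inductive Redex : Type
  | vals (vs : List Val)
  | exc (x : Exc)
  | exp (e : Exp)
  | box

/-- Results: exceptions and value sequences. -/
def Redex.IsResult : Redex → Prop
  | .vals _ => True
  | .exc _ => True
  | .exp _ => False
  | .box => False

/-- Identifiers of parameter list frames. -/
inductive FrameId : Type
  | tuple
  | values
  | call (vm vf : Val)
  | primop (a : Atom)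
  | map
  | app (vf : Val)

/-- Frames. -/
inductive Frame : Type
  /-- `id(v₁, ..., vᵢ₋₁, □, eᵢ₊₁, ..., eₙ)` -/
  | params (id : FrameId) (vs : List Val) (es : List Exp)
  /-- `[e₁ | □]` -/
  | consTail (e₁ : Exp)
  /-- `[□ | v₂]` -/
  | consHead (v₂ : Val)
  /-- `call □:ef(es)` -/
  | callMod (ef : Exp) (es : List Exp)
  /-- `call vm:□(es)` -/
  | callFun (vm : Val) (es : List Exp)
  /-- `apply □(es)` -/
  | app (es : List Exp)
  /-- `case □ of cls end` -/
  | case (cls : List Clause)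
  /-- `case vs of ps when □ -> eb; cls end`; the pattern variables of `ps` have already been
  substituted in `eb`. -/
  | caseGuard (vs : List Val) (ps : List Pat) (eb : Exp) (cls : List Clause)
  /-- `let <xs> = □ in e₂` -/
  | elet (xs : List Var) (e₂ : Exp)
  /-- `do □ e₂` -/
  | seq (e₂ : Exp)
  /-- `try □ of <xs> -> e₂ catch <ys> -> e₃` -/
  | etry (xs : List Var) (e₂ : Exp) (ys : List Var) (e₃ : Exp)

/-- Frame stacks, the top frame first. -/
abbrev FrameStack := List Frame

/-! ## Names, scopes and substitutions -/

mutual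

/-- The variables of a pattern. -/
def Pat.vars : Pat → List Var
  | .int _ => []
  | .atom _ => []
  | .var x => [x]
  | .cons p q => p.vars ++ q.vars
  | .nil => []
  | .tuple ps => Pat.varsList ps
  | .map ps => Pat.varsPairs ps

def Pat.varsList : List Pat → List Var
  | [] => []
  | p :: ps => p.vars ++ Pat.varsList ps

def Pat.varsPairs : List (Pat × Pat) → List Var
  | [] => []
  | (p, q) :: ps => p.vars ++ q.vars ++ Pat.varsPairs ps

end

/-- The names of a list of variables. -/
def varNames (xs : List Var) : List Name := xs.map Name.var

/-- The function identifier bound by a function definition. -/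
def ClosItem.name : ClosItem → Name
  | .mk f xs _ => .fid f xs.length

/-- The function identifiers bound by a list of function definitions. -/
def namesOf (ext : List ClosItem) : List Name := ext.map ClosItem.name

/-- `Γ` extended by the names in a list. -/
def extend (Γ : Set Name) (ns : List Name) : Set Name := Γ ∪ {n | n ∈ ns}

mutual

/-- `Γ ⊢ v`: the free names of the value `v` are in `Γ`. -/
def Val.Scoped (Γ : Set Name) : Val → Prop
  | .int _ => True
  | .atom _ => True
  | .var x => Name.var x ∈ Γ
  | .fid f k => Name.fid f k ∈ Γ
  | .clos ext xs e =>
      ClosItem.ScopedList (extend Γ (namesOf ext)) ext ∧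
        Exp.Scoped (extend (extend Γ (namesOf ext)) (varNames xs)) e
  | .cons v w => Val.Scoped Γ v ∧ Val.Scoped Γ w
  | .nil => True
  | .tuple vs => Val.ScopedList Γ vs
  | .map vs => Val.ScopedPairs Γ vs

def Val.ScopedList (Γ : Set Name) : List Val → Prop
  | [] => True
  | v :: vs => Val.Scoped Γ v ∧ Val.ScopedList Γ vs

def Val.ScopedPairs (Γ : Set Name) : List (Val × Val) → Prop
  | [] => True
  | (v, w) :: vs => Val.Scoped Γ v ∧ Val.Scoped Γ w ∧ Val.ScopedPairs Γ vs

/-- `Γ ⊢ e`: the free names of the expression `e` are in `Γ`. -/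
def Exp.Scoped (Γ : Set Name) : Exp → Prop
  | .val v => Val.Scoped Γ v
  | .lam xs e => Exp.Scoped (extend Γ (varNames xs)) e
  | .values es => Exp.ScopedList Γ es
  | .cons e₁ e₂ => Exp.Scoped Γ e₁ ∧ Exp.Scoped Γ e₂
  | .tuple es => Exp.ScopedList Γ es
  | .map es => Exp.ScopedPairs Γ es
  | .call em ef es => Exp.Scoped Γ em ∧ Exp.Scoped Γ ef ∧ Exp.ScopedList Γ es
  | .primop _ es => Exp.ScopedList Γ es
  | .app e es => Exp.Scoped Γ e ∧ Exp.ScopedList Γ es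
  | .case e cls => Exp.Scoped Γ e ∧ Clause.ScopedList Γ cls
  | .elet xs e₁ e₂ => Exp.Scoped Γ e₁ ∧ Exp.Scoped (extend Γ (varNames xs)) e₂
  | .seq e₁ e₂ => Exp.Scoped Γ e₁ ∧ Exp.Scoped Γ e₂
  | .letrec ext e =>
      ClosItem.ScopedList (extend Γ (namesOf ext)) ext ∧ Exp.Scoped (extend Γ (namesOf ext)) e
  | .etry e₁ xs e₂ ys e₃ =>
      Exp.Scoped Γ e₁ ∧ Exp.Scoped (extend Γ (varNames xs)) e₂ ∧
        Exp.Scoped (extend Γ (varNames ys)) e₃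

def Exp.ScopedList (Γ : Set Name) : List Exp → Prop
  | [] => True
  | e :: es => Exp.Scoped Γ e ∧ Exp.ScopedList Γ es

def Exp.ScopedPairs (Γ : Set Name) : List (Exp × Exp) → Prop
  | [] => True
  | (e, e') :: es => Exp.Scoped Γ e ∧ Exp.Scoped Γ e' ∧ Exp.ScopedPairs Γ es

/-- Every function body is scoped in `Γ` and its own parameters. -/
def ClosItem.ScopedList (Γ : Set Name) : List ClosItem → Prop
  | [] => True
  | .mk _ xs e :: l => Exp.Scoped (extend Γ (varNames xs)) e ∧ ClosItem.ScopedList Γ l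

/-- Every guard and body is scoped in `Γ` and the variables of the patterns of its clause. -/
def Clause.ScopedList (Γ : Set Name) : List Clause → Prop
  | [] => True
  | .mk ps eg eb :: l =>
      Exp.Scoped (extend Γ (varNames (Pat.varsList ps))) eg ∧
        Exp.Scoped (extend Γ (varNames (Pat.varsList ps))) eb ∧ Clause.ScopedList Γ l

end

def Exc.Scoped (Γ : Set Name) (x : Exc) : Prop := x.reason.Scoped Γ ∧ x.details.Scoped Γ

/-- `Γ ⊢ r` for redexes. -/
def Redex.Scoped (Γ : Set Name) : Redex → Prop
  | .vals vs => Val.ScopedList Γ vs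
  | .exc x => x.Scoped Γ
  | .exp e => e.Scoped Γ
  | .box => True

def FrameId.Closed : FrameId → Prop
  | .tuple => True
  | .values => True
  | .call vm vf => vm.Scoped ∅ ∧ vf.Scoped ∅
  | .primop _ => True
  | .map => True
  | .app vf => vf.Scoped ∅

/-- A frame is closed if filling its hole with a closed expression gives a closed expression.
(Filling a parameter list frame for maps gives an expression only if the number of its subvalues
and subexpressions is odd.) -/
def Frame.Closed : Frame → Prop
  | .params id vs es =>
      id.Closed ∧ Val.ScopedList ∅ vs ∧ Exp.ScopedList ∅ es ∧
        (id = FrameId.map → Odd (vs.length + es.length))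
  | .consTail e₁ => e₁.Scoped ∅
  | .consHead v₂ => v₂.Scoped ∅
  | .callMod ef es => ef.Scoped ∅ ∧ Exp.ScopedList ∅ es
  | .callFun vm es => vm.Scoped ∅ ∧ Exp.ScopedList ∅ es
  | .app es => Exp.ScopedList ∅ es
  | .case cls => Clause.ScopedList ∅ cls
  | .caseGuard vs _ eb cls => Val.ScopedList ∅ vs ∧ eb.Scoped ∅ ∧ Clause.ScopedList ∅ cls
  | .elet xs e₂ => e₂.Scoped (extend ∅ (varNames xs))
  | .seq e₂ => e₂.Scoped ∅
  | .etry xs e₂ ys e₃ =>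
      e₂.Scoped (extend ∅ (varNames xs)) ∧ e₃.Scoped (extend ∅ (varNames ys))

/-- A frame stack is closed if all of its frames are. -/
def StackClosed (K : FrameStack) : Prop := ∀ F ∈ K, F.Closed

/-- Parallel substitutions: partial maps from names to values (names outside of the domain are left
unchanged). -/
abbrev Subst := Name → Option Val

/-- The substitution without the names in a list (used below the binders of these names). -/
def Subst.remove (σ : Subst) (ns : List Name) : Subst :=
  fun n => if n ∈ ns then none else σ n

/-- The substitution given by a list of bindings. -/
def Subst.ofList (l : List (Name × Val)) : Subst := fun n => l.lookup n

/-! Application of a substitution. Bound names are not substituted. Binders need no renaming: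
a substitution that is applied to a redex, in the relations below as well as in the evaluation of
closed configurations, consists of closed values, in which no free name can be captured. -/

mutual

def Val.subst (σ : Subst) : Val → Val
  | .int i => .int i
  | .atom a => .atom a
  | .var x => (σ (.var x)).getD (.var x)
  | .fid f k => (σ (.fid f k)).getD (.fid f k)
  | .clos ext xs e =>
      .clos (ClosItem.substList (σ.remove (namesOf ext)) ext) xs
        (Exp.subst ((σ.remove (namesOf ext)).remove (varNames xs)) e)
  | .cons v w => .cons (Val.subst σ v) (Val.subst σ w)
  | .nil => .nil
  | .tuple vs => .tuple (Val.substList σ vs)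
  | .map vs => .map (Val.substPairs σ vs)

def Val.substList (σ : Subst) : List Val → List Val
  | [] => []
  | v :: vs => Val.subst σ v :: Val.substList σ vs

def Val.substPairs (σ : Subst) : List (Val × Val) → List (Val × Val)
  | [] => []
  | (v, w) :: vs => (Val.subst σ v, Val.subst σ w) :: Val.substPairs σ vs

def Exp.subst (σ : Subst) : Exp → Exp
  | .val v => .val (Val.subst σ v)
  | .lam xs e => .lam xs (Exp.subst (σ.remove (varNames xs)) e)
  | .values es => .values (Exp.substList σ es)
  | .cons e₁ e₂ => .cons (Exp.subst σ e₁) (Exp.subst σ e₂)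
  | .tuple es => .tuple (Exp.substList σ es)
  | .map es => .map (Exp.substPairs σ es)
  | .call em ef es => .call (Exp.subst σ em) (Exp.subst σ ef) (Exp.substList σ es)
  | .primop a es => .primop a (Exp.substList σ es)
  | .app e es => .app (Exp.subst σ e) (Exp.substList σ es)
  | .case e cls => .case (Exp.subst σ e) (Clause.substList σ cls)
  | .elet xs e₁ e₂ => .elet xs (Exp.subst σ e₁) (Exp.subst (σ.remove (varNames xs)) e₂)
  | .seq e₁ e₂ => .seq (Exp.subst σ e₁) (Exp.subst σ e₂)
  | .letrec ext e =>
      .letrec (ClosItem.substList (σ.remove (namesOf ext)) ext)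
        (Exp.subst (σ.remove (namesOf ext)) e)
  | .etry e₁ xs e₂ ys e₃ =>
      .etry (Exp.subst σ e₁) xs (Exp.subst (σ.remove (varNames xs)) e₂) ys
        (Exp.subst (σ.remove (varNames ys)) e₃)

def Exp.substList (σ : Subst) : List Exp → List Exp
  | [] => []
  | e :: es => Exp.subst σ e :: Exp.substList σ es

def Exp.substPairs (σ : Subst) : List (Exp × Exp) → List (Exp × Exp)
  | [] => []
  | (e, e') :: es => (Exp.subst σ e, Exp.subst σ e') :: Exp.substPairs σ es

def ClosItem.substList (σ : Subst) : List ClosItem → List ClosItem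
  | [] => []
  | .mk f xs e :: l =>
      .mk f xs (Exp.subst (σ.remove (varNames xs)) e) :: ClosItem.substList σ l

def Clause.substList (σ : Subst) : List Clause → List Clause
  | [] => []
  | .mk ps eg eb :: l =>
      .mk ps (Exp.subst (σ.remove (varNames (Pat.varsList ps))) eg)
        (Exp.subst (σ.remove (varNames (Pat.varsList ps))) eb) :: Clause.substList σ l

end

def Redex.subst (σ : Subst) : Redex → Redex
  | .vals vs => .vals (Val.substList σ vs)
  | .exc x => .exc ⟨x.cls, x.reason.subst σ, x.details.subst σ⟩
  | .exp e => .exp (e.subst σ)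
  | .box => .box

/-- `Γ ⊢ σ ⊸ Δ`: the substitution `σ` maps the names in `Γ` (and no others) to values with free
names in `Δ`. -/
def Subst.Scoped (Γ : Set Name) (σ : Subst) (Δ : Set Name) : Prop :=
  (∀ n ∈ Γ, ∃ v, σ n = some v ∧ v.Scoped Δ) ∧ ∀ n ∉ Γ, σ n = none

/-- The bindings `x₁ ↦ v₁, ..., xₙ ↦ vₙ`. -/
def bindVars (xs : List Var) (vs : List Val) : List (Name × Val) := (varNames xs).zip vs

/-- Every definition `f/k = fun (xs) -> e` of `ext` becomes the binding `f/k ↦ clos ext xs e`. -/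
def mkClosList (ext : List ClosItem) : List (Name × Val) :=
  ext.map fun
    | .mk f xs e => (.fid f xs.length, .clos ext xs e)

/-! ## Pattern matching -/

mutual

/-- The bindings obtained by matching a value against a pattern, `none` if the match fails. -/
def matchPat : Pat → Val → Option (List (Name × Val))
  | .int i, .int j => if i = j then some [] else none
  | .atom a, .atom b => if a = b then some [] else none
  | .var x, v => some [(.var x, v)]
  | .cons p q, .cons v w =>
      (matchPat p v).bind fun l => (matchPat q w).map fun l' => l ++ l'
  | .nil, .nil => some []
  | .tuple ps, .tuple vs => matchPats ps vs
  | .map ps, .map vs => matchPairs ps vs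
  | _, _ => none

/-- Pairwise matching of a list of patterns and a value sequence of the same length. -/
def matchPats : List Pat → List Val → Option (List (Name × Val))
  | [], [] => some []
  | p :: ps, v :: vs =>
      (matchPat p v).bind fun l => (matchPats ps vs).map fun l' => l ++ l'
  | _, _ => none

def matchPairs : List (Pat × Pat) → List (Val × Val) → Option (List (Name × Val))
  | [], [] => some []
  | (p, q) :: ps, (v, w) :: vs =>
      (matchPat p v).bind fun l => (matchPat q w).bind fun l' =>
        (matchPairs ps vs).map fun l'' => l ++ l' ++ l''
  | _, _ => none

end

/-! ## Built-in functions and primitive operations -/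

/-- The kinds of values in the term order: numbers, atoms, functions, tuples, maps, `[]`, non-empty
lists (open values, which are never evaluated in closed configurations, come last). -/
def Val.rank : Val → ℕ
  | .int _ => 0
  | .atom _ => 1
  | .clos _ _ _ => 2
  | .tuple _ => 3
  | .map _ => 4
  | .nil => 5
  | .cons _ _ => 6
  | .var _ => 7
  | .fid _ _ => 8

mutual

/-- The order of terms. Tuples are compared by size, then element by element; maps by size, then by
their keys, then by their values. Functions are compared by arity only: nothing else of a closure is
observable by a built-in function. -/
def Val.cmp : Val → Val → Ordering
  | .int i, .int j => compare i j
  | .atom a, .atom b => compare a b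
  | .var x, .var y => compare x y
  | .fid f k, .fid g l => (compare f g).then (compare k l)
  | .clos _ xs _, .clos _ ys _ => compare xs.length ys.length
  | .cons v w, .cons v' w' => (Val.cmp v v').then (Val.cmp w w')
  | .nil, .nil => .eq
  | .tuple vs, .tuple ws => (compare vs.length ws.length).then (Val.cmpList vs ws)
  | .map vs, .map ws =>
      (compare vs.length ws.length).then ((Val.cmpKeys vs ws).then (Val.cmpVals vs ws))
  | v, w => compare v.rank w.rank

def Val.cmpList : List Val → List Val → Ordering
  | v :: vs, w :: ws => (Val.cmp v w).then (Val.cmpList vs ws)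
  | _, _ => .eq

def Val.cmpKeys : List (Val × Val) → List (Val × Val) → Ordering
  | (k, _) :: vs, (k', _) :: ws => (Val.cmp k k').then (Val.cmpKeys vs ws)
  | _, _ => .eq

def Val.cmpVals : List (Val × Val) → List (Val × Val) → Ordering
  | (_, v) :: vs, (_, w) :: ws => (Val.cmp v w).then (Val.cmpVals vs ws)
  | _, _ => .eq

end

/-- Insertion of an association into a map, kept in the order of its keys; an association with an
equal key is replaced. -/
def mapInsert (k v : Val) : List (Val × Val) → List (Val × Val)
  | [] => [(k, v)]
  | (k', v') :: l =>
      match Val.cmp k k' with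
      | .lt => (k, v) :: (k', v') :: l
      | .eq => (k, v) :: l
      | .gt => (k', v') :: mapInsert k v l

/-- `v₁, v₂, v₃, v₄, ... ` as associations `v₁ => v₂, v₃ => v₄, ...`, if the number is even. -/
def pairUp : List Val → Option (List (Val × Val))
  | [] => some []
  | [_] => none
  | k :: v :: l => (pairUp l).map fun m => (k, v) :: m

/-- The map with the given associations: duplicate keys are eliminated, the last one stays. -/
def mkMap (l : List (Val × Val)) : List (Val × Val) :=
  l.foldl (fun m a => mapInsert a.1 a.2 m) []

/-- The elements of a proper list. -/
def Val.toList : Val → Option (List Val)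
  | .nil => some []
  | .cons v w => (Val.toList w).map fun l => v :: l
  | _ => none

/-- The list `[v₁, ..., vₙ | w]`. -/
def consList (vs : List Val) (w : Val) : Val := vs.foldr Val.cons w

/-- Removal of the first element that is equal to `v`. -/
def removeFirst (v : Val) : List Val → List Val
  | [] => []
  | w :: l => if Val.cmp v w = .eq then l else w :: removeFirst v l

/-! Characters, used to spell the reserved atoms. -/
namespace Ascii

def a : Char := Char.ofNat 97
def b : Char := Char.ofNat 98
def c : Char := Char.ofNat 99
def d : Char := Char.ofNat 100
def e : Char := Char.ofNat 101
def f : Char := Char.ofNat 102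
def g : Char := Char.ofNat 103
def h : Char := Char.ofNat 104
def i : Char := Char.ofNat 105
def j : Char := Char.ofNat 106
def k : Char := Char.ofNat 107
def l : Char := Char.ofNat 108
def m : Char := Char.ofNat 109
def n : Char := Char.ofNat 110
def o : Char := Char.ofNat 111
def p : Char := Char.ofNat 112
def q : Char := Char.ofNat 113
def r : Char := Char.ofNat 114
def s : Char := Char.ofNat 115
def t : Char := Char.ofNat 116
def u : Char := Char.ofNat 117
def v : Char := Char.ofNat 118
def w : Char := Char.ofNat 119
def x : Char := Char.ofNat 120
def y : Char := Char.ofNat 121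
def z : Char := Char.ofNat 122
def cPlus : Char := Char.ofNat 43
def cMinus : Char := Char.ofNat 45
def cStar : Char := Char.ofNat 42
def cEq : Char := Char.ofNat 61
def cColon : Char := Char.ofNat 58
def cSlash : Char := Char.ofNat 47
def cLt : Char := Char.ofNat 60
def cGt : Char := Char.ofNat 62
def cUnder : Char := Char.ofNat 95

end Ascii

def spell (cs : List Char) : Atom := String.ofList cs

section Reserved

open Ascii

def aTrue : Atom := spell [t, r, u, e]
def aFalse : Atom := spell [f, a, l, s, e]
def aThrow : Atom := spell [t, h, r, o, w]
def aExit : Atom := spell [e, x, i, t]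
def aError : Atom := spell [e, r, r, o, r]
def aIfClause : Atom := spell [i, f, cUnder, c, l, a, u, s, e]
def aBadfun : Atom := spell [b, a, d, f, u, n]
def aBadarity : Atom := spell [b, a, d, a, r, i, t, y]
def aBadarg : Atom := spell [b, a, d, a, r, g]
def aBadarith : Atom := spell [b, a, d, a, r, i, t, h]
def aUndef : Atom := spell [u, n, d, e, f]
def aErlang : Atom := spell [e, r, l, a, n, g]
def aMatchFail : Atom := spell [m, a, t, c, h, cUnder, f, a, i, l]
def aArity : Atom := spell [a, r, i, t, y]

/-- Codes of the built-in functions of the module `erlang`. -/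
inductive Bif : Type
  | plus | minus | times | div | rem | bsl | bsr | abs | and | or | xor | not | eq | exactEq | ne
  | exactNe | lt | le | gt | ge | append | subtract | length | hd | tl | tupleSize | element
  | setelement | tupleToList | listToTuple | isInteger | isNumber | isAtom | isBoolean
  | isFunction | isList | isTuple | isMap | funInfo | error | exit | throw | raise

/-- The atom naming a built-in function. -/
def Bif.name : Bif → Atom
  | .plus => spell [cPlus]
  | .minus => spell [cMinus]
  | .times => spell [cStar]
  | .div => spell [d, i, v]
  | .rem => spell [r, e, m]
  | .bsl => spell [b, s, l]
  | .bsr => spell [b, s, r]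
  | .abs => spell [a, b, s]
  | .and => spell [a, n, d]
  | .or => spell [o, r]
  | .xor => spell [x, o, r]
  | .not => spell [n, o, t]
  | .eq => spell [cEq, cEq]
  | .exactEq => spell [cEq, cColon, cEq]
  | .ne => spell [cSlash, cEq]
  | .exactNe => spell [cEq, cSlash, cEq]
  | .lt => spell [cLt]
  | .le => spell [cEq, cLt]
  | .gt => spell [cGt]
  | .ge => spell [cGt, cEq]
  | .append => spell [cPlus, cPlus]
  | .subtract => spell [cMinus, cMinus]
  | .length => spell [l, e, n, g, t, h]
  | .hd => spell [h, d]
  | .tl => spell [t, l]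
  | .tupleSize => spell [t, u, p, l, e, cUnder, s, i, z, e]
  | .element => spell [e, l, e, m, e, n, t]
  | .setelement => spell [s, e, t, e, l, e, m, e, n, t]
  | .tupleToList => spell [t, u, p, l, e, cUnder, t, o, cUnder, l, i, s, t]
  | .listToTuple => spell [l, i, s, t, cUnder, t, o, cUnder, t, u, p, l, e]
  | .isInteger => spell [i, s, cUnder, i, n, t, e, g, e, r]
  | .isNumber => spell [i, s, cUnder, n, u, m, b, e, r]
  | .isAtom => spell [i, s, cUnder, a, t, o, m]
  | .isBoolean => spell [i, s, cUnder, b, o, o, l, e, a, n]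
  | .isFunction => spell [i, s, cUnder, f, u, n, c, t, i, o, n]
  | .isList => spell [i, s, cUnder, l, i, s, t]
  | .isTuple => spell [i, s, cUnder, t, u, p, l, e]
  | .isMap => spell [i, s, cUnder, m, a, p]
  | .funInfo => spell [f, u, n, cUnder, i, n, f, o]
  | .error => spell [e, r, r, o, r]
  | .exit => spell [e, x, i, t]
  | .throw => spell [t, h, r, o, w]
  | .raise => spell [r, a, i, s, e]

def Bif.all : List Bif :=
  [.plus, .minus, .times, .div, .rem, .bsl, .bsr, .abs, .and, .or, .xor, .not, .eq, .exactEq,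
    .ne, .exactNe, .lt, .le, .gt, .ge, .append, .subtract, .length, .hd, .tl, .tupleSize,
    .element, .setelement, .tupleToList, .listToTuple, .isInteger, .isNumber, .isAtom,
    .isBoolean, .isFunction, .isList, .isTuple, .isMap, .funInfo, .error, .exit, .throw, .raise]

end Reserved

def bifTable (m f : Atom) : Option Bif :=
  if m = aErlang then Bif.all.find? (fun b => b.name = f) else none

def ExcClass.atom : ExcClass → Atom
  | .throw => aThrow
  | .exit => aExit
  | .error => aError

/-- The result consisting of one value. -/
def ret (v : Val) : Redex := .vals [v]

def boolVal (b : Bool) : Val := .atom (if b then aTrue else aFalse)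

def toBool (v : Val) : Option Bool :=
  match v with
  | .atom a => if a = aTrue then some true else if a = aFalse then some false else none
  | _ => none

/-- The exception `{error, reason, details}ˣ`. -/
def err (reason : Atom) (details : Val) : Redex := .exc ⟨.error, .atom reason, details⟩

/-- The details of a failed call: the function with its arguments. -/
def blame (b : Bif) (args : List Val) : Val := .tuple (.atom b.name :: args)

def badarith (b : Bif) (args : List Val) : Redex := err aBadarith (blame b args)

def badarg (b : Bif) (args : List Val) : Redex := err aBadarg (blame b args)

/-- Binary arithmetic; `op` is undefined where the operation fails. -/
def arith (b : Bif) (op : ℤ → ℤ → Option ℤ) (v w : Val) : Redex :=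
  match v, w with
  | .int i, .int j => (op i j).elim (badarith b [v, w]) fun k => ret (.int k)
  | _, _ => badarith b [v, w]

def arithUnary (b : Bif) (op : ℤ → ℤ) (v : Val) : Redex :=
  match v with
  | .int i => ret (.int (op i))
  | _ => badarith b [v]

def boolean (b : Bif) (op : Bool → Bool → Bool) (v w : Val) : Redex :=
  match toBool v, toBool w with
  | some x, some y => ret (boolVal (op x y))
  | _, _ => badarg b [v, w]

/-- Arithmetic shift to the left by `j` bits (to the right if `j` is negative). -/
def shiftLeft (i j : ℤ) : ℤ :=
  if 0 ≤ j then i * 2 ^ j.toNat else i / 2 ^ (-j).toNat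

/-- Element `i` (counted from 1) of a list. -/
def nth? (l : List Val) (i : ℤ) : Option Val :=
  if 1 ≤ i then l[(i - 1).toNat]? else none

def toClass (v : Val) : Option ExcClass :=
  match v with
  | .atom a =>
      if a = aThrow then some .throw
      else if a = aExit then some .exit
      else if a = aError then some .error
      else none
  | _ => none

/-- The empty details of an exception. -/
def noDetails : Val := .tuple []

/-- The behaviour of the built-in functions. -/
def evalBif (b : Bif) (args : List Val) : Redex :=
  match b, args with
  | .plus, [v, w] => arith b (fun i j => some (i + j)) v w
  | .plus, [v] => arithUnary b (fun i => i) v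
  | .minus, [v, w] => arith b (fun i j => some (i - j)) v w
  | .minus, [v] => arithUnary b (fun i => -i) v
  | .times, [v, w] => arith b (fun i j => some (i * j)) v w
  | .div, [v, w] => arith b (fun i j => if j = 0 then none else some (i.tdiv j)) v w
  | .rem, [v, w] => arith b (fun i j => if j = 0 then none else some (i.tmod j)) v w
  | .bsl, [v, w] => arith b (fun i j => some (shiftLeft i j)) v w
  | .bsr, [v, w] => arith b (fun i j => some (shiftLeft i (-j))) v w
  | .abs, [.int i] => ret (.int |i|)
  | .abs, [v] => badarg b [v]
  | .and, [v, w] => boolean b (fun x y => x && y) v w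
  | .or, [v, w] => boolean b (fun x y => x || y) v w
  | .xor, [v, w] => boolean b (fun x y => x != y) v w
  | .not, [v] => (toBool v).elim (badarg b [v]) fun x => ret (boolVal (!x))
  | .eq, [v, w] => ret (boolVal (Val.cmp v w).isEq)
  | .exactEq, [v, w] => ret (boolVal (Val.cmp v w).isEq)
  | .ne, [v, w] => ret (boolVal (Val.cmp v w).isNe)
  | .exactNe, [v, w] => ret (boolVal (Val.cmp v w).isNe)
  | .lt, [v, w] => ret (boolVal (Val.cmp v w).isLT)
  | .le, [v, w] => ret (boolVal (Val.cmp v w).isLE)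
  | .gt, [v, w] => ret (boolVal (Val.cmp v w).isGT)
  | .ge, [v, w] => ret (boolVal (Val.cmp v w).isGE)
  | .append, [v, w] => v.toList.elim (badarg b [v, w]) fun l => ret (consList l w)
  | .subtract, [v, w] =>
      v.toList.elim (badarg b [v, w]) fun l => w.toList.elim (badarg b [v, w]) fun l' =>
        ret (consList (l'.foldl (fun acc x => removeFirst x acc) l) .nil)
  | .length, [v] => v.toList.elim (badarg b [v]) fun l => ret (.int l.length)
  | .hd, [.cons v _] => ret v
  | .hd, [v] => badarg b [v]
  | .tl, [.cons _ w] => ret w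
  | .tl, [v] => badarg b [v]
  | .tupleSize, [.tuple vs] => ret (.int vs.length)
  | .tupleSize, [v] => badarg b [v]
  | .element, [.int i, .tuple vs] => (nth? vs i).elim (badarg b [.int i, .tuple vs]) ret
  | .element, [v, w] => badarg b [v, w]
  | .setelement, [.int i, .tuple vs, u] =>
      (nth? vs i).elim (badarg b [.int i, .tuple vs, u]) fun _ =>
        ret (.tuple (vs.set (i - 1).toNat u))
  | .setelement, [v, w, u] => badarg b [v, w, u]
  | .tupleToList, [.tuple vs] => ret (consList vs .nil)
  | .tupleToList, [v] => badarg b [v]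
  | .listToTuple, [v] => v.toList.elim (badarg b [v]) fun l => ret (.tuple l)
  | .isInteger, [v] => ret (boolVal (v.rank == 0))
  | .isNumber, [v] => ret (boolVal (v.rank == 0))
  | .isAtom, [v] => ret (boolVal (v.rank == 1))
  | .isBoolean, [v] => ret (boolVal (toBool v).isSome)
  | .isFunction, [v] => ret (boolVal (v.rank == 2))
  | .isFunction, [v, .int i] =>
      if 0 ≤ i then
        match v with
        | .clos _ xs _ => ret (boolVal (decide (i = xs.length)))
        | _ => ret (boolVal false)
      else badarg b [v, .int i]
  | .isFunction, [v, w] => badarg b [v, w]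
  | .isList, [v] => ret (boolVal (v.rank == 5 || v.rank == 6))
  | .isTuple, [v] => ret (boolVal (v.rank == 3))
  | .isMap, [v] => ret (boolVal (v.rank == 4))
  | .funInfo, [.clos ext xs e, .atom a] =>
      if a = aArity then ret (.tuple [.atom aArity, .int xs.length])
      else badarg b [.clos ext xs e, .atom a]
  | .funInfo, [v, w] => badarg b [v, w]
  | .error, [v] => .exc ⟨.error, v, noDetails⟩
  | .error, [v, w] => .exc ⟨.error, v, w⟩
  | .exit, [v] => .exc ⟨.exit, v, noDetails⟩
  | .throw, [v] => .exc ⟨.throw, v, noDetails⟩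
  | .raise, [v, w, u] => (toClass v).elim (badarg b [v, w, u]) fun c => .exc ⟨c, w, u⟩
  | _, _ => err aUndef (.tuple (.atom aErlang :: .atom b.name :: args))

/-- The result of `call m:f(args)`. -/
def evalCall (m f : Val) (args : List Val) : Redex :=
  match m, f with
  | .atom am, .atom af =>
      (bifTable am af).elim (err aUndef (.tuple (.atom am :: .atom af :: args))) fun b =>
        evalBif b args
  | _, _ => err aBadarg (.tuple [m, f])

/-- The result of `primop a(args)`. -/
def evalPrimop (a : Atom) (args : List Val) : Redex :=
  match args with
  | [v] => if a = aMatchFail then .exc ⟨.error, v, noDetails⟩ else err aUndef (.tuple [.atom a, v])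
  | _ => err aUndef (.tuple (.atom a :: args))

/-- The result of applying a function value to parameters. -/
def evalApp (vf : Val) (args : List Val) : Redex :=
  match vf with
  | .clos ext xs e =>
      if xs.length = args.length then
        .exp (e.subst (Subst.ofList (bindVars xs args ++ mkClosList ext)))
      else err aBadarity vf
  | _ => err aBadfun vf

/-- The redex constructed from a frame identifier and its parameters; it is undefined only for maps
with an odd number of parameters. -/
def eval (id : FrameId) (vs : List Val) : Option Redex :=
  match id with
  | .tuple => some (ret (.tuple vs))
  | .values => some (.vals vs)
  | .call m f => some (evalCall m f vs)
  | .primop a => some (evalPrimop a vs)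
  | .map => (pairUp vs).map fun l => ret (.map (mkMap l))
  | .app vf => some (evalApp vf vs)

/-! ## Frame stack semantics -/

/-- `e₁ᵏ => e₁ᵛ, e₂ᵏ => e₂ᵛ, ...` as the list `e₁ᵏ, e₁ᵛ, e₂ᵏ, e₂ᵛ, ...` -/
def flatten : List (Exp × Exp) → List Exp
  | [] => []
  | (k, v) :: l => k :: v :: flatten l

def Frame.IsTry : Frame → Prop
  | .etry _ _ _ _ => True
  | _ => False

/-- One step of evaluation, `⟨K, r⟩ ⟶ ⟨K', r'⟩`. -/
inductive Step : FrameStack → Redex → FrameStack → Redex → Prop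
  -- extracting the first redex of an expression
  | sConsTail (K e₁ e₂) : Step K (.exp (.cons e₁ e₂)) (.consTail e₁ :: K) (.exp e₂)
  | sLet (K xs e₁ e₂) : Step K (.exp (.elet xs e₁ e₂)) (.elet xs e₂ :: K) (.exp e₁)
  | sSeq (K e₁ e₂) : Step K (.exp (.seq e₁ e₂)) (.seq e₂ :: K) (.exp e₁)
  | sApp (K e es) : Step K (.exp (.app e es)) (.app es :: K) (.exp e)
  | sCallMod (K em ef es) : Step K (.exp (.call em ef es)) (.callMod ef es :: K) (.exp em)
  | sPrimOp (K a es) : Step K (.exp (.primop a es)) (.params (.primop a) [] es :: K) .box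
  | sVals (K es) : Step K (.exp (.values es)) (.params .values [] es :: K) .box
  | sTuple (K es) : Step K (.exp (.tuple es)) (.params .tuple [] es :: K) .box
  | sMap (K ek ev es) :
      Step K (.exp (.map ((ek, ev) :: es))) (.params .map [] (ev :: flatten es) :: K) (.exp ek)
  | sCase (K e cls) : Step K (.exp (.case e cls)) (.case cls :: K) (.exp e)
  -- modifying the top frame
  | sConsHead (K e₁ v₂) : Step (.consTail e₁ :: K) (.vals [v₂]) (.consHead v₂ :: K) (.exp e₁)
  | sCallFun (K ef es vm) :
      Step (.callMod ef es :: K) (.vals [vm]) (.callFun vm es :: K) (.exp ef)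
  | sCallParam (K vm es vf) :
      Step (.callFun vm es :: K) (.vals [vf]) (.params (.call vm vf) [] es :: K) .box
  | sAppParam (K es v) : Step (.app es :: K) (.vals [v]) (.params (.app v) [] es :: K) .box
  | sCaseFail (K ps eg eb cls vs) (h : matchPats ps vs = none) :
      Step (.case (.mk ps eg eb :: cls) :: K) (.vals vs) (.case cls :: K) (.vals vs)
  | sCaseSuccess (K ps eg eb cls vs l) (h : matchPats ps vs = some l) :
      Step (.case (.mk ps eg eb :: cls) :: K) (.vals vs)
        (.caseGuard vs ps (eb.subst (Subst.ofList l)) cls :: K)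
        (.exp (eg.subst (Subst.ofList l)))
  | sCaseFalse (K vs ps eb cls) :
      Step (.caseGuard vs ps eb cls :: K) (.vals [.atom aFalse]) (.case cls :: K) (.vals vs)
  | sParams₀ (K id e es) (h : id ≠ FrameId.map) :
      Step (.params id [] (e :: es) :: K) .box (.params id [] es :: K) (.exp e)
  | sParams (K id vs v e es) :
      Step (.params id vs (e :: es) :: K) (.vals [v])
        (.params id (vs ++ [v]) es :: K) (.exp e)
  -- removing the top frame, and steps that leave the stack unchanged
  | pMap₀ (K) : Step K (.exp (.map [])) K (.vals [.map []])
  | pFun (K xs e) : Step K (.exp (.lam xs e)) K (.vals [.clos [] xs e])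
  | pLetRec (K ext e) :
      Step K (.exp (.letrec ext e)) K (.exp (e.subst (Subst.ofList (mkClosList ext))))
  | pValue (K v) : Step K (.exp (.val v)) K (.vals [v])
  | pParams₀ (K id vs r) (h : id ≠ FrameId.map) (hr : eval id vs = some r) :
      Step (.params id vs [] :: K) .box K r
  | pParams (K id vs v r) (hr : eval id (vs ++ [v]) = some r) :
      Step (.params id vs [] :: K) (.vals [v]) K r
  | pCons (K v₁ v₂) : Step (.consHead v₂ :: K) (.vals [v₁]) K (.vals [.cons v₁ v₂])
  | pCaseTrue (K vs ps eb cls) :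
      Step (.caseGuard vs ps eb cls :: K) (.vals [.atom aTrue]) K (.exp eb)
  | pLet (K xs e₂ vs) (h : xs.length = vs.length) :
      Step (.elet xs e₂ :: K) (.vals vs) K (.exp (e₂.subst (Subst.ofList (bindVars xs vs))))
  | pSeq (K e₂ v₁) : Step (.seq e₂ :: K) (.vals [v₁]) K (.exp e₂)
  -- exceptions
  | excCase (K vs) : Step (.case [] :: K) (.vals vs) K (err aIfClause noDetails)
  | sTry (K e₁ xs e₂ ys e₃) :
      Step K (.exp (.etry e₁ xs e₂ ys e₃)) (.etry xs e₂ ys e₃ :: K) (.exp e₁)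
  | pTry (K xs e₂ ys e₃ vs) (h : xs.length = vs.length) :
      Step (.etry xs e₂ ys e₃ :: K) (.vals vs) K
        (.exp (e₂.subst (Subst.ofList (bindVars xs vs))))
  | excTry (K xs e₂ y₁ y₂ y₃ e₃ c vr vd) :
      Step (.etry xs e₂ [y₁, y₂, y₃] e₃ :: K) (.exc ⟨c, vr, vd⟩) K
        (.exp (e₃.subst (Subst.ofList (bindVars [y₁, y₂, y₃] [.atom c.atom, vr, vd]))))
  | excProp (K F x) (h : ¬ F.IsTry) : Step (F :: K) (.exc x) K (.exc x)

/-- `⟨K, r⟩ ⟶ⁿ ⟨K', r'⟩`. -/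
inductive Steps : ℕ → FrameStack → Redex → FrameStack → Redex → Prop
  | refl (K r) : Steps 0 K r K r
  | step {n K r K' r' K'' r''} (h : Step K r K' r') (hs : Steps n K' r' K'' r'') :
      Steps (n + 1) K r K'' r''

/-- `⟨K, r⟩ ⇓ⁿ`: termination in `n` steps, with a result in the empty frame stack. -/
def TermIn (n : ℕ) (K : FrameStack) (r : Redex) : Prop :=
  ∃ res : Redex, res.IsResult ∧ Steps n K r [] res

/-- `⟨K, r⟩ ⇓` -/
def Term (K : FrameStack) (r : Redex) : Prop := ∃ n, TermIn n K r

/-! ## Step-indexed logical relations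

The relations on exceptions, frame stacks and redexes are first defined from any family of relations
on values at the indices up to `n`; the relation on values at index `n` is then defined by recursion
from the relations at smaller indices. All relations are between closed objects. -/

/-- Related exceptions, for a given relation on values. -/
def ExcRelOf (V : Val → Val → Prop) (x₁ x₂ : Exc) : Prop :=
  x₁.cls = x₂.cls ∧ V x₁.reason x₂.reason ∧ V x₁.details x₂.details

/-- Related frame stacks at index `n`. -/
def StackRelOf (n : ℕ) (V : ∀ m, m ≤ n → Val → Val → Prop) (K₁ K₂ : FrameStack) : Prop :=
  StackClosed K₁ ∧ StackClosed K₂ ∧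
  (∀ (m : ℕ) (hm : m ≤ n) (vs₁ vs₂ : List Val), List.Forall₂ (V m hm) vs₁ vs₂ →
    TermIn m K₁ (.vals vs₁) → Term K₂ (.vals vs₂)) ∧
  (∀ (m : ℕ) (hm : m ≤ n) (x₁ x₂ : Exc), ExcRelOf (V m hm) x₁ x₂ →
    TermIn m K₁ (.exc x₁) → Term K₂ (.exc x₂)) ∧
  (∀ m : ℕ, m ≤ n → TermIn m K₁ .box → Term K₂ .box)

/-- Related redexes at index `n`. -/
def RedexRelOf (n : ℕ) (V : ∀ m, m ≤ n → Val → Val → Prop) (r₁ r₂ : Redex) : Prop :=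
  r₁.Scoped ∅ ∧ r₂.Scoped ∅ ∧
  ∀ (m : ℕ) (hm : m ≤ n) (K₁ K₂ : FrameStack),
    StackRelOf m (fun k hk => V k (hk.trans hm)) K₁ K₂ → TermIn m K₁ r₁ → Term K₂ r₂

/-- Related expressions at index `n`. -/
def ExpRelOf (n : ℕ) (V : ∀ m, m ≤ n → Val → Val → Prop) (e₁ e₂ : Exp) : Prop :=
  RedexRelOf n V (.exp e₁) (.exp e₂)

/-- Related values at index `n`, for given relations at the indices below `n`. Closures have to agree
in the number of their parameters (the names of bound variables are irrelevant). -/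
inductive ValRelOf (n : ℕ) (V : ∀ m, m < n → Val → Val → Prop) : Val → Val → Prop
  | int (i : ℤ) : ValRelOf n V (.int i) (.int i)
  | atom (a : Atom) : ValRelOf n V (.atom a) (.atom a)
  | nil : ValRelOf n V .nil .nil
  | cons {v₁ v₂ w₁ w₂ : Val} (hv : ValRelOf n V v₁ v₂) (hw : ValRelOf n V w₁ w₂) :
      ValRelOf n V (.cons v₁ w₁) (.cons v₂ w₂)
  | tuple {vs₁ vs₂ : List Val} (h : List.Forall₂ (ValRelOf n V) vs₁ vs₂) :
      ValRelOf n V (.tuple vs₁) (.tuple vs₂)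
  | map {vs₁ vs₂ : List (Val × Val)}
      (hk : List.Forall₂ (fun a b => ValRelOf n V a.1 b.1) vs₁ vs₂)
      (hv : List.Forall₂ (fun a b => ValRelOf n V a.2 b.2) vs₁ vs₂) :
      ValRelOf n V (.map vs₁) (.map vs₂)
  | clos {ext₁ ext₂ : List ClosItem} {xs₁ xs₂ : List Var} {e₁ e₂ : Exp}
      (h₁ : (Val.clos ext₁ xs₁ e₁).Scoped ∅) (h₂ : (Val.clos ext₂ xs₂ e₂).Scoped ∅)
      (hlen : xs₁.length = xs₂.length)
      (h : ∀ (m : ℕ) (hm : m < n) (vs₁ vs₂ : List Val), vs₁.length = xs₁.length →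
        List.Forall₂ (V m hm) vs₁ vs₂ →
        ExpRelOf m (fun k hk => V k (hk.trans_lt hm))
          (e₁.subst (Subst.ofList (bindVars xs₁ vs₁ ++ mkClosList ext₁)))
          (e₂.subst (Subst.ofList (bindVars xs₂ vs₂ ++ mkClosList ext₂)))) :
      ValRelOf n V (.clos ext₁ xs₁ e₁) (.clos ext₂ xs₂ e₂)

/-- Related values at index `n`. -/
def ValRel (n : ℕ) : Val → Val → Prop := ValRelOf n fun m _ => ValRel m
termination_by n

/-- Related frame stacks at index `n`. -/
def StackRel (n : ℕ) : FrameStack → FrameStack → Prop := StackRelOf n fun m _ => ValRel m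

/-- Related redexes at index `n`. -/
def RedexRel (n : ℕ) : Redex → Redex → Prop := RedexRelOf n fun m _ => ValRel m

/-- Related closing substitutions for `Γ` at index `n`. -/
def SubstRel (Γ : Set Name) (n : ℕ) (σ₁ σ₂ : Subst) : Prop :=
  σ₁.Scoped Γ ∅ ∧ σ₂.Scoped Γ ∅ ∧
    ∀ x ∈ Γ, ∃ v₁ v₂, σ₁ x = some v₁ ∧ σ₂ x = some v₂ ∧ ValRel n v₁ v₂

/-- The logical relation for open redexes. -/
def RedexRelOpen (Γ : Set Name) (r₁ r₂ : Redex) : Prop :=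
  ∀ (n : ℕ) (σ₁ σ₂ : Subst), SubstRel Γ n σ₁ σ₂ → RedexRel n (r₁.subst σ₁) (r₂.subst σ₂)

/-! ## CIU preorder -/

/-- The CIU preorder. -/
def CIU (r₁ r₂ : Redex) : Prop :=
  r₁.Scoped ∅ ∧ r₂.Scoped ∅ ∧ ∀ K : FrameStack, StackClosed K ∧ Term K r₁ → Term K r₂

/-- The CIU preorder for open redexes. -/
def CIUOpen (Γ : Set Name) (r₁ r₂ : Redex) : Prop :=
  ∀ σ : Subst, σ.Scoped Γ ∅ → CIU (r₁.subst σ) (r₂.subst σ)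

end CoreErlang

/-!
The logical relation is biorthogonal: two redexes are related at index `n` if related frame stacks
cannot tell them apart within `n` steps. Hence the comparison with the CIU preorder, which runs both
redexes in one and the same stack, reduces to reflexivity of the logical relation.

* If `r₁` is below `r₂` in the CIU preorder, then `r₁` under `σ₁` is related to `r₁` under `σ₂` by
  reflexivity (`Redex.Scoped.redexRel`), and the CIU preorder, applied in the right-hand stack and
  for `σ₂`, replaces the second `r₁` by `r₂`. That `r₁` has its free names in `Γ`, as reflexivity
  requires, follows from its closing instances being closed (`Redex.scoped_of_subst`).
* If `r₁` and `r₂` are related, then they can be compared in a closed stack `K` and under a closing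
  substitution `σ` because `K` and `σ` are related to themselves (`StackClosed.stackRel_self`,
  `Subst.Scoped.substRel_self`).

Reflexivity is the fundamental property of the relation (`fundamental`): related closing
substitutions take every expression to related expressions. It is proved by induction on the syntax.
Each construct only needs the frames it pushes to be compatible with the relation
(`StackRel.params`, `StackRel.case` and their neighbours), and a frame is compatible if each of its
steps on related results can be simulated; a step decreases the index, and the right-hand side never
has to match the number of steps. Three facts about values enter here: built-in functions take
related arguments to related results (`ResRel.evalBif`), because they inspect closures only through
their arity; pattern matching succeeds or fails alike on related values (`BindRel.matchPats`); and
applying a closure takes a step, so that closures related at `n` suffice to relate their bodies at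
all smaller indices (`IdRel.eval`). The last fact is also what makes recursive definitions work: the
closures of a `letrec` are related at every index by induction on the index
(`Compat.bindRel_mkClosList`).

Composing a closing substitution with the bindings made during evaluation is harmless because all
substituted values are closed (`Exp.subst_subst`).
-/

namespace CoreErlang

/-! ### Induction on the syntax -/

/-- The parameters of a function definition. -/
def ClosItem.params : ClosItem → List Var
  | .mk _ xs _ => xs

/-- The body of a function definition. -/
def ClosItem.body : ClosItem → Exp
  | .mk _ _ e => e

/-- The patterns of a clause. -/
def Clause.pats : Clause → List Pat
  | .mk ps _ _ => ps

/-- The guard of a clause. -/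
def Clause.guard : Clause → Exp
  | .mk _ eg _ => eg

/-- The body of a clause. -/
def Clause.body : Clause → Exp
  | .mk _ _ eb => eb

/-- Simultaneous induction on values and expressions. Lists of subterms are handled by membership,
so that the mutual recursion through lists, pairs, function definitions and clauses does not have to
be repeated. -/
theorem syntax_induction {PV : Val → Prop} {PE : Exp → Prop}
    (int : ∀ i, PV (.int i)) (atom : ∀ a, PV (.atom a)) (var : ∀ x, PV (.var x))
    (fid : ∀ f k, PV (.fid f k))
    (clos : ∀ ext xs e, (∀ c ∈ ext, PE c.body) → PE e → PV (.clos ext xs e))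
    (vcons : ∀ v w, PV v → PV w → PV (.cons v w)) (nil : PV .nil)
    (vtuple : ∀ vs, (∀ v ∈ vs, PV v) → PV (.tuple vs))
    (vmap : ∀ vs, (∀ p ∈ vs, PV p.1 ∧ PV p.2) → PV (.map vs))
    (val : ∀ v, PV v → PE (.val v))
    (lam : ∀ xs e, PE e → PE (.lam xs e))
    (values : ∀ es, (∀ e ∈ es, PE e) → PE (.values es))
    (cons : ∀ e₁ e₂, PE e₁ → PE e₂ → PE (.cons e₁ e₂))
    (tuple : ∀ es, (∀ e ∈ es, PE e) → PE (.tuple es))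
    (map : ∀ es, (∀ p ∈ es, PE p.1 ∧ PE p.2) → PE (.map es))
    (call : ∀ em ef es, PE em → PE ef → (∀ e ∈ es, PE e) → PE (.call em ef es))
    (primop : ∀ a es, (∀ e ∈ es, PE e) → PE (.primop a es))
    (app : ∀ e es, PE e → (∀ e ∈ es, PE e) → PE (.app e es))
    (case : ∀ e cls, PE e → (∀ c ∈ cls, PE c.guard ∧ PE c.body) → PE (.case e cls))
    (elet : ∀ xs e₁ e₂, PE e₁ → PE e₂ → PE (.elet xs e₁ e₂))
    (seq : ∀ e₁ e₂, PE e₁ → PE e₂ → PE (.seq e₁ e₂))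
    (letrec : ∀ ext e, (∀ c ∈ ext, PE c.body) → PE e → PE (.letrec ext e))
    (etry : ∀ e₁ xs e₂ ys e₃, PE e₁ → PE e₂ → PE e₃ → PE (.etry e₁ xs e₂ ys e₃)) :
    (∀ v, PV v) ∧ ∀ e, PE e := by
  constructor
  · refine Val.rec (motive_1 := PV) (motive_2 := PE) (motive_3 := fun c => PE c.body)
      (motive_4 := fun c => PE c.guard ∧ PE c.body) (motive_5 := fun l => ∀ c ∈ l, PE c.body)
      (motive_6 := fun l => ∀ v ∈ l, PV v) (motive_7 := fun l => ∀ p ∈ l, PV p.1 ∧ PV p.2)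
      (motive_8 := fun l => ∀ e ∈ l, PE e) (motive_9 := fun l => ∀ p ∈ l, PE p.1 ∧ PE p.2)
      (motive_10 := fun l => ∀ c ∈ l, PE c.guard ∧ PE c.body)
      (motive_11 := fun p => PV p.1 ∧ PV p.2)
      (motive_12 := fun p => PE p.1 ∧ PE p.2)
      int atom var fid clos vcons nil vtuple vmap val lam values cons tuple map call primop app case
      elet seq letrec etry ?_ ?_ ?_ ?_ ?_ ?_ ?_ ?_ ?_ ?_ ?_ ?_ ?_ ?_ ?_ ?_ <;>
    simp +contextual [ClosItem.body, Clause.guard, Clause.body]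
  · refine Exp.rec (motive_1 := PV) (motive_2 := PE) (motive_3 := fun c => PE c.body)
      (motive_4 := fun c => PE c.guard ∧ PE c.body) (motive_5 := fun l => ∀ c ∈ l, PE c.body)
      (motive_6 := fun l => ∀ v ∈ l, PV v) (motive_7 := fun l => ∀ p ∈ l, PV p.1 ∧ PV p.2)
      (motive_8 := fun l => ∀ e ∈ l, PE e) (motive_9 := fun l => ∀ p ∈ l, PE p.1 ∧ PE p.2)
      (motive_10 := fun l => ∀ c ∈ l, PE c.guard ∧ PE c.body)
      (motive_11 := fun p => PV p.1 ∧ PV p.2)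
      (motive_12 := fun p => PE p.1 ∧ PE p.2)
      int atom var fid clos vcons nil vtuple vmap val lam values cons tuple map call primop app case
      elet seq letrec etry ?_ ?_ ?_ ?_ ?_ ?_ ?_ ?_ ?_ ?_ ?_ ?_ ?_ ?_ ?_ ?_ <;>
    simp +contextual [ClosItem.body, Clause.guard, Clause.body]

/-! ### Scopes and substitutions -/

theorem Val.scopedList_iff {Γ : Set Name} {vs : List Val} :
    Val.ScopedList Γ vs ↔ ∀ v ∈ vs, v.Scoped Γ := by
  induction vs <;> simp_all [Val.ScopedList]

theorem Val.scopedPairs_iff {Γ : Set Name} {vs : List (Val × Val)} :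
    Val.ScopedPairs Γ vs ↔ ∀ p ∈ vs, p.1.Scoped Γ ∧ p.2.Scoped Γ := by
  induction vs <;> simp_all [Val.ScopedPairs, and_assoc]

theorem Exp.scopedList_iff {Γ : Set Name} {es : List Exp} :
    Exp.ScopedList Γ es ↔ ∀ e ∈ es, e.Scoped Γ := by
  induction es <;> simp_all [Exp.ScopedList]

theorem Exp.scopedPairs_iff {Γ : Set Name} {es : List (Exp × Exp)} :
    Exp.ScopedPairs Γ es ↔ ∀ p ∈ es, p.1.Scoped Γ ∧ p.2.Scoped Γ := by
  induction es <;> simp_all [Exp.ScopedPairs, and_assoc]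

theorem ClosItem.scopedList_iff {Γ : Set Name} {ext : List ClosItem} :
    ClosItem.ScopedList Γ ext ↔ ∀ c ∈ ext, c.body.Scoped (extend Γ (varNames c.params)) := by
  induction ext with
  | nil => simp [ClosItem.ScopedList]
  | cons c ext ih => cases c; simp_all [ClosItem.ScopedList, ClosItem.body, ClosItem.params]

theorem Clause.scopedList_iff {Γ : Set Name} {cls : List Clause} :
    Clause.ScopedList Γ cls ↔
      ∀ c ∈ cls, c.guard.Scoped (extend Γ (varNames (Pat.varsList c.pats))) ∧
        c.body.Scoped (extend Γ (varNames (Pat.varsList c.pats))) := by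
  induction cls with
  | nil => simp [Clause.ScopedList]
  | cons c cls ih =>
    cases c; simp_all [Clause.ScopedList, Clause.guard, Clause.body, Clause.pats, and_assoc]

/-- Substitution in a function definition. -/
def ClosItem.subst (σ : Subst) : ClosItem → ClosItem
  | .mk f xs e => .mk f xs (e.subst (σ.remove (varNames xs)))

/-- Substitution in a clause. -/
def Clause.subst (σ : Subst) : Clause → Clause
  | .mk ps eg eb =>
      .mk ps (eg.subst (σ.remove (varNames (Pat.varsList ps))))
        (eb.subst (σ.remove (varNames (Pat.varsList ps))))

theorem Val.substList_eq_map (σ : Subst) (vs : List Val) :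
    Val.substList σ vs = vs.map (Val.subst σ) := by
  induction vs <;> simp_all [Val.substList]

theorem Val.substPairs_eq_map (σ : Subst) (vs : List (Val × Val)) :
    Val.substPairs σ vs = vs.map fun p => (p.1.subst σ, p.2.subst σ) := by
  induction vs <;> simp_all [Val.substPairs]

theorem Exp.substList_eq_map (σ : Subst) (es : List Exp) :
    Exp.substList σ es = es.map (Exp.subst σ) := by
  induction es <;> simp_all [Exp.substList]

theorem Exp.substPairs_eq_map (σ : Subst) (es : List (Exp × Exp)) :
    Exp.substPairs σ es = es.map fun p => (p.1.subst σ, p.2.subst σ) := by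
  induction es <;> simp_all [Exp.substPairs]

theorem ClosItem.substList_eq_map (σ : Subst) (ext : List ClosItem) :
    ClosItem.substList σ ext = ext.map (ClosItem.subst σ) := by
  induction ext with
  | nil => simp [ClosItem.substList]
  | cons c ext ih => cases c; simp_all [ClosItem.substList, ClosItem.subst]

theorem Clause.substList_eq_map (σ : Subst) (cls : List Clause) :
    Clause.substList σ cls = cls.map (Clause.subst σ) := by
  induction cls with
  | nil => simp [Clause.substList]
  | cons c ext ih => cases c; simp_all [Clause.substList, Clause.subst]

@[simp] theorem ClosItem.params_subst (σ : Subst) (c : ClosItem) :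
    (c.subst σ).params = c.params := by cases c; rfl

@[simp] theorem ClosItem.body_subst (σ : Subst) (c : ClosItem) :
    (c.subst σ).body = c.body.subst (σ.remove (varNames c.params)) := by cases c; rfl

@[simp] theorem ClosItem.name_subst (σ : Subst) (c : ClosItem) :
    (c.subst σ).name = c.name := by cases c; rfl

@[simp] theorem Clause.pats_subst (σ : Subst) (c : Clause) :
    (c.subst σ).pats = c.pats := by cases c; rfl

@[simp] theorem Clause.guard_subst (σ : Subst) (c : Clause) :
    (c.subst σ).guard = c.guard.subst (σ.remove (varNames (Pat.varsList c.pats))) := by cases c; rfl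

@[simp] theorem Clause.body_subst (σ : Subst) (c : Clause) :
    (c.subst σ).body = c.body.subst (σ.remove (varNames (Pat.varsList c.pats))) := by cases c; rfl

theorem ClosItem.eq_iff {c d : ClosItem} :
    c = d ↔ c.name = d.name ∧ c.params = d.params ∧ c.body = d.body := by
  cases c; cases d
  simp only [ClosItem.mk.injEq, ClosItem.name, ClosItem.params, ClosItem.body, Name.fid.injEq]
  grind

theorem Clause.eq_iff {c d : Clause} :
    c = d ↔ c.pats = d.pats ∧ c.guard = d.guard ∧ c.body = d.body := by
  cases c; cases d; simp [Clause.pats, Clause.guard, Clause.body]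

theorem map_eq_self_iff {α : Type*} {f : α → α} {l : List α} :
    l.map f = l ↔ ∀ a ∈ l, f a = a := by
  simpa using List.map_inj_left (f := f) (g := id) (l := l)

@[simp] theorem namesOf_map_subst (σ : Subst) (ext : List ClosItem) :
    namesOf (ext.map (ClosItem.subst σ)) = namesOf ext := by
  simp [namesOf, Function.comp_def]

theorem mem_extend {Γ : Set Name} {ns : List Name} {n : Name} :
    n ∈ extend Γ ns ↔ n ∈ Γ ∨ n ∈ ns := Iff.rfl

theorem extend_mono {Γ Δ : Set Name} (h : Γ ⊆ Δ) (ns : List Name) : extend Γ ns ⊆ extend Δ ns :=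
  Set.union_subset_union_left _ h

theorem subset_extend (Γ : Set Name) (ns : List Name) : Γ ⊆ extend Γ ns :=
  Set.subset_union_left

theorem extend_nil (Γ : Set Name) : extend Γ [] = Γ := by
  ext; simp [mem_extend]

theorem Subst.remove_nil (σ : Subst) : σ.remove [] = σ := by
  ext; simp [Subst.remove]

theorem scoped_mono_aux :
    (∀ v : Val, ∀ Γ Δ : Set Name, Γ ⊆ Δ → v.Scoped Γ → v.Scoped Δ) ∧
      ∀ e : Exp, ∀ Γ Δ : Set Name, Γ ⊆ Δ → e.Scoped Γ → e.Scoped Δ := by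
  apply syntax_induction <;> intros <;>
    simp only [Val.Scoped, Exp.Scoped, Val.scopedList_iff, Val.scopedPairs_iff, Exp.scopedList_iff,
      Exp.scopedPairs_iff, ClosItem.scopedList_iff, Clause.scopedList_iff] at * <;>
    grind [extend_mono]

theorem Val.Scoped.mono {v : Val} {Γ Δ : Set Name} (hv : v.Scoped Γ) (h : Γ ⊆ Δ) : v.Scoped Δ :=
  scoped_mono_aux.1 v Γ Δ h hv

theorem Exp.Scoped.mono {e : Exp} {Γ Δ : Set Name} (he : e.Scoped Γ) (h : Γ ⊆ Δ) : e.Scoped Δ :=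
  scoped_mono_aux.2 e Γ Δ h he

/-- `σ` is undefined on `Γ`. -/
def Subst.UndefOn (σ : Subst) (Γ : Set Name) : Prop := ∀ n ∈ Γ, σ n = none

theorem Subst.UndefOn.remove {σ : Subst} {Γ : Set Name} (h : σ.UndefOn Γ) (ns : List Name) :
    (σ.remove ns).UndefOn (extend Γ ns) := by
  intro n hn
  by_cases hm : n ∈ ns
  · simp [Subst.remove, hm]
  · simpa [Subst.remove, hm] using h n (hn.resolve_right hm)

theorem subst_eq_self_aux :
    (∀ v : Val, ∀ (Γ : Set Name) (σ : Subst), σ.UndefOn Γ → v.Scoped Γ → v.subst σ = v) ∧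
      ∀ e : Exp, ∀ (Γ : Set Name) (σ : Subst), σ.UndefOn Γ → e.Scoped Γ → e.subst σ = e := by
  apply syntax_induction
  case var | fid =>
    intros
    simp only [Val.subst]
    rename_i σ hσ hn
    rw [hσ _ hn]
    rfl
  all_goals
    intros
    simp only [Val.Scoped, Exp.Scoped, Val.scopedList_iff, Val.scopedPairs_iff, Exp.scopedList_iff,
      Exp.scopedPairs_iff, ClosItem.scopedList_iff, Clause.scopedList_iff] at *
    simp [Val.subst, Exp.subst,
      Val.substList_eq_map, Val.substPairs_eq_map, Exp.substList_eq_map, Exp.substPairs_eq_map,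
      ClosItem.substList_eq_map, Clause.substList_eq_map, map_eq_self_iff, ClosItem.eq_iff,
      Clause.eq_iff, Prod.ext_iff]
    try (split_ands <;> intros <;> grind [Subst.UndefOn.remove])

theorem Val.Scoped.subst_eq_self {v : Val} (hv : v.Scoped ∅) (σ : Subst) : v.subst σ = v :=
  subst_eq_self_aux.1 v ∅ σ (fun _ h => h.elim) hv

theorem Exp.Scoped.subst_eq_self {e : Exp} (he : e.Scoped ∅) (σ : Subst) : e.subst σ = e :=
  subst_eq_self_aux.2 e ∅ σ (fun _ h => h.elim) he

/-- `σ` takes names in `Γ` to values with free names in `Δ`; where `σ` is undefined, the name itself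
is in `Δ`. -/
def Subst.MapsTo (σ : Subst) (Γ Δ : Set Name) : Prop :=
  ∀ n ∈ Γ, (∀ w, σ n = some w → w.Scoped Δ) ∧ (σ n = none → n ∈ Δ)

theorem Subst.MapsTo.remove {σ : Subst} {Γ Δ : Set Name} (h : σ.MapsTo Γ Δ) (ns : List Name) :
    (σ.remove ns).MapsTo (extend Γ ns) (extend Δ ns) := by
  intro n hn
  by_cases hm : n ∈ ns
  · simp [Subst.remove, hm, mem_extend]
  · have := h n (hn.resolve_right hm)
    simp only [Subst.remove, hm, if_false]
    exact ⟨fun w hw => (this.1 w hw).mono (subset_extend _ _), fun hw => Or.inl (this.2 hw)⟩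

theorem scoped_subst_aux :
    (∀ v : Val, ∀ (Γ Δ : Set Name) (σ : Subst), σ.MapsTo Γ Δ → v.Scoped Γ → (v.subst σ).Scoped Δ) ∧
    ∀ e : Exp, ∀ (Γ Δ : Set Name) (σ : Subst), σ.MapsTo Γ Δ → e.Scoped Γ →
      (e.subst σ).Scoped Δ := by
  apply syntax_induction
  case int | atom | nil => intros; trivial
  case var | fid =>
    intros
    rename_i σ hσ hn
    have := hσ _ hn
    simp only [Val.subst]
    cases h : σ _
    · exact this.2 h
    · exact this.1 _ h
  all_goals
    intros
    simp only [Val.Scoped, Exp.Scoped, Val.scopedList_iff, Val.scopedPairs_iff, Exp.scopedList_iff,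
      Exp.scopedPairs_iff, ClosItem.scopedList_iff, Clause.scopedList_iff, Val.subst, Exp.subst,
      Val.substList_eq_map, Val.substPairs_eq_map, Exp.substList_eq_map, Exp.substPairs_eq_map,
      ClosItem.substList_eq_map, Clause.substList_eq_map, List.forall_mem_map, namesOf_map_subst,
      ClosItem.params_subst, ClosItem.body_subst, Clause.pats_subst, Clause.guard_subst,
      Clause.body_subst] at *
    split_ands <;> intros <;> grind [Subst.MapsTo.remove]

theorem Subst.Scoped.mapsTo {Γ Δ : Set Name} {σ : Subst} (h : σ.Scoped Γ Δ) : σ.MapsTo Γ Δ := by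
  intro n hn
  obtain ⟨v, hv, hs⟩ := h.1 n hn
  simp [hv, hs]

theorem Val.Scoped.subst {v : Val} {Γ Δ : Set Name} {σ : Subst} (hv : v.Scoped Γ)
    (h : σ.Scoped Γ Δ) : (v.subst σ).Scoped Δ :=
  scoped_subst_aux.1 v Γ Δ σ h.mapsTo hv

theorem Exp.Scoped.subst {e : Exp} {Γ Δ : Set Name} {σ : Subst} (he : e.Scoped Γ)
    (h : σ.Scoped Γ Δ) : (e.subst σ).Scoped Δ :=
  scoped_subst_aux.2 e Γ Δ σ h.mapsTo he

/-- `σ` is undefined outside of `Γ`. -/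
def Subst.DefWithin (σ : Subst) (Γ : Set Name) : Prop := ∀ n ∉ Γ, σ n = none

theorem Subst.DefWithin.remove {σ : Subst} {Γ : Set Name} (h : σ.DefWithin Γ) (ns : List Name) :
    (σ.remove ns).DefWithin (extend Γ ns) := by
  intro n hn
  rw [mem_extend, not_or] at hn
  simp [Subst.remove, hn.2, h n hn.1]

/-- Converse of `scoped_subst_aux`: substitution for names in `Γ` removes no other free names. -/
theorem scoped_of_subst_aux :
    (∀ v : Val, ∀ (Γ Δ : Set Name) (σ : Subst), Δ ⊆ Γ → σ.DefWithin Γ →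
      (v.subst σ).Scoped Δ → v.Scoped Γ) ∧
    ∀ e : Exp, ∀ (Γ Δ : Set Name) (σ : Subst), Δ ⊆ Γ → σ.DefWithin Γ →
      (e.subst σ).Scoped Δ → e.Scoped Γ := by
  apply syntax_induction
  case int | atom | nil => intros; trivial
  case var | fid =>
    intro _
    intros
    by_contra hn
    rename_i hΔ hσ hs
    simp only [Val.subst, hσ _ hn] at hs
    exact hn (hΔ hs)
  all_goals
    intros
    simp only [Val.Scoped, Exp.Scoped, Val.scopedList_iff, Val.scopedPairs_iff, Exp.scopedList_iff,
      Exp.scopedPairs_iff, ClosItem.scopedList_iff, Clause.scopedList_iff, Val.subst, Exp.subst,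
      Val.substList_eq_map, Val.substPairs_eq_map, Exp.substList_eq_map, Exp.substPairs_eq_map,
      ClosItem.substList_eq_map, Clause.substList_eq_map, List.forall_mem_map, namesOf_map_subst,
      ClosItem.params_subst, ClosItem.body_subst, Clause.pats_subst, Clause.guard_subst,
      Clause.body_subst] at *
    split_ands <;> intros <;> grind [extend_mono, Subst.DefWithin.remove]

/-- If closing `r` for the names in `Γ` gives a closed redex, all free names of `r` are in `Γ`. -/
theorem Redex.scoped_of_subst {r : Redex} {Γ : Set Name} {σ : Subst} (h : σ.DefWithin Γ)
    (hr : (r.subst σ).Scoped ∅) : r.Scoped Γ := by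
  have hv := fun v => scoped_of_subst_aux.1 v Γ ∅ σ (Set.empty_subset _) h
  have he := fun e => scoped_of_subst_aux.2 e Γ ∅ σ (Set.empty_subset _) h
  cases r <;> simp_all [Redex.Scoped, Redex.subst, Val.scopedList_iff, Val.substList_eq_map,
    Exc.Scoped]

/-- The substitution `σ`, followed by `τ` on the names where `σ` is undefined. For a substitution
`σ` by closed values this is the composite. -/
def Subst.orElse (σ τ : Subst) : Subst := fun n => (σ n).or (τ n)

theorem Subst.orElse_remove (σ τ : Subst) (ns : List Name) :
    (σ.orElse τ).remove ns = (σ.remove ns).orElse (τ.remove ns) := by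
  funext n
  by_cases hm : n ∈ ns <;> simp [Subst.remove, Subst.orElse, hm]

/-- All values of `σ` are closed. -/
def Subst.Closed (σ : Subst) : Prop := ∀ n w, σ n = some w → w.Scoped ∅

theorem Subst.Closed.remove {σ : Subst} (h : σ.Closed) (ns : List Name) : (σ.remove ns).Closed := by
  intro n w
  by_cases hm : n ∈ ns <;> simp [Subst.remove, hm]
  exact h n w

theorem subst_subst_aux :
    (∀ v : Val, ∀ σ τ : Subst, σ.Closed → (v.subst σ).subst τ = v.subst (σ.orElse τ)) ∧
    ∀ e : Exp, ∀ σ τ : Subst, σ.Closed → (e.subst σ).subst τ = e.subst (σ.orElse τ) := by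
  apply syntax_induction
  case int | atom | nil => intros; trivial
  case var | fid =>
    intro _
    intros
    rename_i σ τ hσ
    simp only [Val.subst, Subst.orElse]
    cases h : σ _
    · simp [Val.subst]
    · simpa using (hσ _ _ h).subst_eq_self _
  case vmap | map =>
    intro es ih σ τ hσ
    simp only [Val.subst, Exp.subst, Val.substPairs_eq_map, Exp.substPairs_eq_map, List.map_map,
      Val.map.injEq, Exp.map.injEq, List.map_inj_left]
    exact fun p hp => Prod.ext ((ih p hp).1 _ _ hσ) ((ih p hp).2 _ _ hσ)
  all_goals
    intros
    simp [Val.subst, Exp.subst,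
      Val.substList_eq_map, Exp.substList_eq_map, ClosItem.substList_eq_map,
      Clause.substList_eq_map, Subst.orElse_remove, ClosItem.eq_iff, Clause.eq_iff]
    try (split_ands <;> intros <;> grind [Subst.Closed.remove])

/-- Successive substitutions by closed values can be performed at once, because closed values are
not affected by the second substitution. -/
theorem Exp.subst_subst {e : Exp} {σ τ : Subst} (h : σ.Closed) :
    (e.subst σ).subst τ = e.subst (σ.orElse τ) :=
  subst_subst_aux.2 e σ τ h

/-! ### Related values -/

theorem forall₂_imp_of_mem {α β : Type*} {R S : α → β → Prop} {l₁ : List α} {l₂ : List β}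
    (h : List.Forall₂ R l₁ l₂) (hS : ∀ a ∈ l₁, ∀ b, R a b → S a b) : List.Forall₂ S l₁ l₂ := by
  induction h with
  | nil => exact .nil
  | cons h _ ih =>
    exact .cons (hS _ (by simp) _ h) (ih fun a ha b hb => hS a (by simp [ha]) b hb)

/-- The condition under which closures are related at index `n`. -/
def ClosRel (n : ℕ) (ext₁ : List ClosItem) (xs₁ : List Var) (e₁ : Exp)
    (ext₂ : List ClosItem) (xs₂ : List Var) (e₂ : Exp) : Prop :=
  (Val.clos ext₁ xs₁ e₁).Scoped ∅ ∧ (Val.clos ext₂ xs₂ e₂).Scoped ∅ ∧ xs₁.length = xs₂.length ∧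
    ∀ m < n, ∀ vs₁ vs₂ : List Val, vs₁.length = xs₁.length →
      List.Forall₂ (ValRel m) vs₁ vs₂ →
      RedexRel m (.exp (e₁.subst (Subst.ofList (bindVars xs₁ vs₁ ++ mkClosList ext₁))))
        (.exp (e₂.subst (Subst.ofList (bindVars xs₂ vs₂ ++ mkClosList ext₂))))

theorem valRelOf_eq (n : ℕ) : (ValRelOf n fun m _ => ValRel m) = ValRel n := by
  rw [ValRel]

theorem ValRel.int {n : ℕ} (i : ℤ) : ValRel n (.int i) (.int i) := by
  rw [ValRel]; exact .int i

theorem ValRel.atom {n : ℕ} (a : Atom) : ValRel n (.atom a) (.atom a) := by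
  rw [ValRel]; exact .atom a

theorem ValRel.nil {n : ℕ} : ValRel n .nil .nil := by
  rw [ValRel]; exact .nil

theorem ValRel.cons {n : ℕ} {v₁ v₂ w₁ w₂ : Val} (hv : ValRel n v₁ v₂) (hw : ValRel n w₁ w₂) :
    ValRel n (.cons v₁ w₁) (.cons v₂ w₂) := by
  rw [ValRel] at *; exact .cons hv hw

theorem ValRel.tuple {n : ℕ} {vs₁ vs₂ : List Val} (h : List.Forall₂ (ValRel n) vs₁ vs₂) :
    ValRel n (.tuple vs₁) (.tuple vs₂) := by
  rw [ValRel] at *; exact .tuple h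

/-- Related associations. -/
def PairRel (n : ℕ) (p q : Val × Val) : Prop := ValRel n p.1 q.1 ∧ ValRel n p.2 q.2

theorem ValRel.map {n : ℕ} {vs₁ vs₂ : List (Val × Val)} (h : List.Forall₂ (PairRel n) vs₁ vs₂) :
    ValRel n (.map vs₁) (.map vs₂) := by
  have h₁ := h.imp fun _ _ h => h.1
  have h₂ := h.imp fun _ _ h => h.2
  rw [ValRel] at *; exact .map h₁ h₂

theorem ValRel.clos {n : ℕ} {ext₁ xs₁ e₁ ext₂ xs₂ e₂} (h : ClosRel n ext₁ xs₁ e₁ ext₂ xs₂ e₂) :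
    ValRel n (.clos ext₁ xs₁ e₁) (.clos ext₂ xs₂ e₂) := by
  rw [ValRel]; exact .clos h.1 h.2.1 h.2.2.1 h.2.2.2

/-- Induction on related values, at a fixed index. Closures are leaves: the values occurring in
their bodies play no role. The motive mentions the proof only for the sake of the `induction`
tactic. -/
@[elab_as_elim]
theorem ValRel.induction {n : ℕ} {P : ∀ v w, ValRel n v w → Prop}
    (int : ∀ i, P _ _ (.int i)) (atom : ∀ a, P _ _ (.atom a)) (nil : P _ _ .nil)
    (cons : ∀ v₁ v₂ w₁ w₂ (hv : ValRel n v₁ v₂) (hw : ValRel n w₁ w₂), P _ _ hv → P _ _ hw →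
      P _ _ (.cons hv hw))
    (tuple : ∀ vs₁ vs₂ (h : List.Forall₂ (fun v w => ∃ h : ValRel n v w, P v w h) vs₁ vs₂),
      P _ _ (.tuple (h.imp fun _ _ h => h.fst)))
    (map : ∀ vs₁ vs₂ (h : List.Forall₂ (fun p q : Val × Val =>
        (∃ h : ValRel n p.1 q.1, P p.1 q.1 h) ∧ ∃ h : ValRel n p.2 q.2, P p.2 q.2 h) vs₁ vs₂),
      P _ _ (.map (h.imp fun _ _ h => ⟨h.1.fst, h.2.fst⟩)))
    (clos : ∀ ext₁ xs₁ e₁ ext₂ xs₂ e₂ (h : ClosRel n ext₁ xs₁ e₁ ext₂ xs₂ e₂), P _ _ (.clos h))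
    {v w : Val} (h : ValRel n v w) : P v w h := by
  have key := syntax_induction (PV := fun v => ∀ w (h : ValRel n v w), P v w h)
    (PE := fun _ => True)
  simp only [implies_true, forall_const] at key
  refine (key ?_ ?_ ?_ ?_ ?_ ?_ ?_ ?_ ?_).1 v w h <;> clear h v w key
  · intro i w h; have h' := h; rw [ValRel] at h'; cases h'; exact int i
  · intro a w h; have h' := h; rw [ValRel] at h'; cases h'; exact atom a
  · intro x w h; have h' := h; rw [ValRel] at h'; cases h'
  · intro f k w h; have h' := h; rw [ValRel] at h'; cases h'
  · intro ext xs e w h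
    have h₀ := h
    rw [ValRel] at h₀
    cases h₀ with
    | clos h₁ h₂ hl hc => exact clos _ _ _ _ _ _ ⟨h₁, h₂, hl, hc⟩
  · intro v w hv hw u h
    have h₀ := h
    rw [ValRel] at h₀
    cases h₀ with
    | cons h₁ h₂ =>
      rw [valRelOf_eq] at h₁ h₂
      exact cons _ _ _ _ h₁ h₂ (hv _ h₁) (hw _ h₂)
  · intro w h; have h' := h; rw [ValRel] at h'; cases h'; exact nil
  · intro vs ih w h
    have h₀ := h
    rw [ValRel] at h₀
    cases h₀ with
    | tuple h₁ =>
      rw [valRelOf_eq] at h₁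
      exact tuple _ _ (forall₂_imp_of_mem h₁ fun v hv w hw => ⟨hw, ih v hv w hw⟩)
  · intro vs ih w h
    have h₀ := h
    rw [ValRel] at h₀
    cases h₀ with
    | map hk hv =>
      have := hk.mp (fun _ _ => And.intro) hv
      rw [valRelOf_eq] at this
      exact map _ _ (forall₂_imp_of_mem this fun p hp q hq =>
        ⟨⟨hq.1, (ih p hp).1 _ hq.1⟩, hq.2, (ih p hp).2 _ hq.2⟩)

/-- Case distinction on related values. -/
@[elab_as_elim]
theorem ValRel.cases' {n : ℕ} {P : ∀ v w, ValRel n v w → Prop}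
    (int : ∀ i, P _ _ (.int i)) (atom : ∀ a, P _ _ (.atom a)) (nil : P _ _ .nil)
    (cons : ∀ v₁ v₂ w₁ w₂ (hv : ValRel n v₁ v₂) (hw : ValRel n w₁ w₂), P _ _ (.cons hv hw))
    (tuple : ∀ vs₁ vs₂ (h : List.Forall₂ (ValRel n) vs₁ vs₂), P _ _ (.tuple h))
    (map : ∀ vs₁ vs₂ (h : List.Forall₂ (PairRel n) vs₁ vs₂), P _ _ (.map h))
    (clos : ∀ ext₁ xs₁ e₁ ext₂ xs₂ e₂ (h : ClosRel n ext₁ xs₁ e₁ ext₂ xs₂ e₂), P _ _ (.clos h))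
    {v w : Val} (h : ValRel n v w) : P v w h :=
  h.induction int atom nil (fun _ _ _ _ h h' _ _ => cons _ _ _ _ h h')
    (fun _ _ h => tuple _ _ (h.imp fun _ _ h => h.fst))
    (fun _ _ h => map _ _ (h.imp fun _ _ h => ⟨h.1.fst, h.2.fst⟩)) clos

theorem ValRel.mono {m n : ℕ} (hmn : m ≤ n) {v w : Val} (h : ValRel n v w) : ValRel m v w := by
  induction h using ValRel.induction with
  | int i => exact .int i
  | atom a => exact .atom a
  | nil => exact .nil
  | cons _ _ _ _ _ _ h h' => exact .cons h h'
  | tuple _ _ h => exact .tuple (h.imp fun _ _ h => h.snd)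
  | map _ _ h => exact .map (h.imp fun _ _ h => ⟨h.1.snd, h.2.snd⟩)
  | clos _ _ _ _ _ _ h =>
    exact .clos ⟨h.1, h.2.1, h.2.2.1, fun k hk => h.2.2.2 k (hk.trans_le hmn)⟩

theorem ValRel.forall₂_mono {m n : ℕ} (hmn : m ≤ n) {vs ws : List Val}
    (h : List.Forall₂ (ValRel n) vs ws) : List.Forall₂ (ValRel m) vs ws :=
  h.imp fun _ _ => ValRel.mono hmn

theorem forall_right_of_forall₂ {α β : Type*} {R : α → β → Prop} {p : β → Prop} {l₁ : List α}
    {l₂ : List β} (h : List.Forall₂ R l₁ l₂) (hp : ∀ a b, R a b → p b) : ∀ b ∈ l₂, p b := by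
  induction h with
  | nil => simp
  | cons h _ ih => simpa using ⟨hp _ _ h, ih⟩

theorem forall_left_of_forall₂ {α β : Type*} {R : α → β → Prop} {p : α → Prop} {l₁ : List α}
    {l₂ : List β} (h : List.Forall₂ R l₁ l₂) (hp : ∀ a b, R a b → p a) : ∀ a ∈ l₁, p a := by
  induction h with
  | nil => simp
  | cons h _ ih => simpa using ⟨hp _ _ h, ih⟩

theorem ValRel.scoped {n : ℕ} {v w : Val} (h : ValRel n v w) : v.Scoped ∅ ∧ w.Scoped ∅ := by
  induction h using ValRel.induction with
  | int | atom | nil => simp [Val.Scoped]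
  | cons => simp_all [Val.Scoped]
  | tuple _ _ h =>
    simp only [Val.Scoped, Val.scopedList_iff]
    exact ⟨forall_left_of_forall₂ h fun _ _ h => h.snd.1,
      forall_right_of_forall₂ h fun _ _ h => h.snd.2⟩
  | map _ _ h =>
    simp only [Val.Scoped, Val.scopedPairs_iff]
    exact ⟨forall_left_of_forall₂ h fun _ _ h => ⟨h.1.snd.1, h.2.snd.1⟩,
      forall_right_of_forall₂ h fun _ _ h => ⟨h.1.snd.2, h.2.snd.2⟩⟩
  | clos _ _ _ _ _ _ h => exact ⟨h.1, h.2.1⟩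

theorem ValRel.scopedList {n : ℕ} {vs ws : List Val} (h : List.Forall₂ (ValRel n) vs ws) :
    Val.ScopedList ∅ vs ∧ Val.ScopedList ∅ ws := by
  simp only [Val.scopedList_iff]
  exact ⟨forall_left_of_forall₂ h fun _ _ h => h.scoped.1,
    forall_right_of_forall₂ h fun _ _ h => h.scoped.2⟩

theorem StackRel.mono {m n : ℕ} (hmn : m ≤ n) {K₁ K₂ : FrameStack} (h : StackRel n K₁ K₂) :
    StackRel m K₁ K₂ :=
  ⟨h.1, h.2.1, fun k hk => h.2.2.1 k (hk.trans hmn), fun k hk => h.2.2.2.1 k (hk.trans hmn),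
    fun k hk => h.2.2.2.2 k (hk.trans hmn)⟩

theorem RedexRel.mono {m n : ℕ} (hmn : m ≤ n) {r₁ r₂ : Redex} (h : RedexRel n r₁ r₂) :
    RedexRel m r₁ r₂ :=
  ⟨h.1, h.2.1, fun k hk => h.2.2 k (hk.trans hmn)⟩

/-! ### Built-in functions on related arguments -/

theorem ValRel.rank_eq {n : ℕ} {v w : Val} (h : ValRel n v w) : v.rank = w.rank := by
  cases h using ValRel.cases' <;> rfl

/-- Related values are indistinguishable by the term order, which looks at closures only through
their arity. -/
theorem ValRel.cmp_eq {n : ℕ} {v₁ v₂ w₁ w₂ : Val} (hv : ValRel n v₁ v₂) (hw : ValRel n w₁ w₂) :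
    Val.cmp v₁ w₁ = Val.cmp v₂ w₂ := by
  induction hv using ValRel.induction generalizing w₁ w₂ with
  | int | atom | nil => cases hw using ValRel.cases' <;> simp [Val.cmp, Val.rank]
  | cons _ _ _ _ _ _ ihv ihw =>
    cases hw using ValRel.cases' <;> simp [Val.cmp, Val.rank]
    rename_i h h'
    rw [ihv h, ihw h']
  | tuple vs₁ vs₂ h =>
    have key : ∀ ws₁ ws₂, List.Forall₂ (ValRel n) ws₁ ws₂ →
        Val.cmpList vs₁ ws₁ = Val.cmpList vs₂ ws₂ := by
      induction h with
      | nil => intros; simp [Val.cmpList]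
      | cons h _ ih =>
        rintro _ _ (_ | ⟨hw, hws⟩)
        · simp [Val.cmpList]
        · rw [Val.cmpList, Val.cmpList, h.snd hw, ih _ _ hws]
    cases hw using ValRel.cases' <;> simp [Val.cmp, Val.rank]
    rename_i h'
    rw [h.length_eq, h'.length_eq, key _ _ h']
  | map vs₁ vs₂ h =>
    have key₁ : ∀ ws₁ ws₂, List.Forall₂ (PairRel n) ws₁ ws₂ →
        Val.cmpKeys vs₁ ws₁ = Val.cmpKeys vs₂ ws₂ := by
      induction h with
      | nil => intros; simp [Val.cmpKeys]
      | cons h _ ih =>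
        rintro _ _ (_ | ⟨hw, hws⟩)
        · simp [Val.cmpKeys]
        · rw [Val.cmpKeys, Val.cmpKeys, h.1.snd hw.1, ih _ _ hws]
    have key₂ : ∀ ws₁ ws₂, List.Forall₂ (PairRel n) ws₁ ws₂ →
        Val.cmpVals vs₁ ws₁ = Val.cmpVals vs₂ ws₂ := by
      clear key₁
      induction h with
      | nil => intros; simp [Val.cmpVals]
      | cons h _ ih =>
        rintro _ _ (_ | ⟨hw, hws⟩)
        · simp [Val.cmpVals]
        · rw [Val.cmpVals, Val.cmpVals, h.2.snd hw.2, ih _ _ hws]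
    cases hw using ValRel.cases' <;> simp [Val.cmp, Val.rank]
    rename_i h'
    rw [h.length_eq, h'.length_eq, key₁ _ _ h', key₂ _ _ h']
  | clos _ _ _ _ _ _ h =>
    cases hw using ValRel.cases' <;> simp [Val.cmp, Val.rank]
    rename_i h'
    rw [h.2.2.1, h'.2.2.1]

theorem optionRel_bind {α β γ δ : Type*} {R : α → β → Prop} {S : γ → δ → Prop} {o₁ : Option α}
    {o₂ : Option β} {f : α → Option γ} {g : β → Option δ} (h : Option.Rel R o₁ o₂)
    (hf : ∀ a b, R a b → Option.Rel S (f a) (g b)) : Option.Rel S (o₁.bind f) (o₂.bind g) := by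
  cases h with
  | none => exact .none
  | some h => exact hf _ _ h

theorem optionRel_map {α β γ δ : Type*} {R : α → β → Prop} {S : γ → δ → Prop} {o₁ : Option α}
    {o₂ : Option β} {f : α → γ} {g : β → δ} (h : Option.Rel R o₁ o₂)
    (hf : ∀ a b, R a b → S (f a) (g b)) : Option.Rel S (o₁.map f) (o₂.map g) := by
  cases h with
  | none => exact .none
  | some h => exact .some (hf _ _ h)

/-- Related results. -/
inductive ResRel (n : ℕ) : Redex → Redex → Prop
  | vals {vs ws : List Val} (h : List.Forall₂ (ValRel n) vs ws) : ResRel n (.vals vs) (.vals ws)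
  | exc (c : ExcClass) {v₁ v₂ w₁ w₂ : Val} (hv : ValRel n v₁ v₂) (hw : ValRel n w₁ w₂) :
      ResRel n (.exc ⟨c, v₁, w₁⟩) (.exc ⟨c, v₂, w₂⟩)

theorem ResRel.ret {n : ℕ} {v w : Val} (h : ValRel n v w) : ResRel n (ret v) (ret w) :=
  .vals (.cons h .nil)

theorem ResRel.err {n : ℕ} (a : Atom) {v w : Val} (h : ValRel n v w) :
    ResRel n (err a v) (err a w) :=
  .exc _ (.atom a) h

theorem ResRel.retBool {n : ℕ} {x y : Bool} (h : x = y) :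
    ResRel n (CoreErlang.ret (boolVal x)) (CoreErlang.ret (boolVal y)) :=
  h ▸ .ret (.atom _)

theorem ValRel.noDetails {n : ℕ} : ValRel n noDetails noDetails := .tuple .nil

section Bif

variable {n : ℕ} {b : Bif}

theorem ResRel.badarg {as bs : List Val} (h : List.Forall₂ (ValRel n) as bs) :
    ResRel n (badarg b as) (badarg b bs) :=
  .err _ (.tuple (.cons (.atom _) h))

theorem ResRel.badarith {as bs : List Val} (h : List.Forall₂ (ValRel n) as bs) :
    ResRel n (badarith b as) (badarith b bs) :=
  .err _ (.tuple (.cons (.atom _) h))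

theorem ResRel.undef {m f : Atom} {as bs : List Val} (h : List.Forall₂ (ValRel n) as bs) :
    ResRel n (CoreErlang.err aUndef (.tuple (.atom m :: .atom f :: as)))
      (CoreErlang.err aUndef (.tuple (.atom m :: .atom f :: bs))) :=
  .err _ (.tuple (.cons (.atom _) (.cons (.atom _) h)))

theorem ResRel.elim {α β : Type*} {R : α → β → Prop} {o₁ : Option α} {o₂ : Option β} {d₁ d₂ : Redex}
    {f : α → Redex} {g : β → Redex} (ho : Option.Rel R o₁ o₂) (hd : ResRel n d₁ d₂)
    (hf : ∀ a b, R a b → ResRel n (f a) (g b)) : ResRel n (o₁.elim d₁ f) (o₂.elim d₂ g) := by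
  cases ho with
  | none => exact hd
  | some h => exact hf _ _ h

theorem forall₂_pair {α β : Type*} {R : α → β → Prop} {a a' : α} {b b' : β} (h : R a b)
    (h' : R a' b') : List.Forall₂ R [a, a'] [b, b'] := .cons h (.cons h' .nil)

theorem forall₂_triple {α β : Type*} {R : α → β → Prop} {a a' a'' : α} {b b' b'' : β} (h : R a b)
    (h' : R a' b') (h'' : R a'' b'') : List.Forall₂ R [a, a', a''] [b, b', b''] :=
  .cons h (forall₂_pair h' h'')

theorem forall₂_single {α β : Type*} {R : α → β → Prop} {a : α} {b : β} (h : R a b) :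
    List.Forall₂ R [a] [b] := .cons h .nil

variable {v₁ v₂ w₁ w₂ u₁ u₂ : Val}

theorem ResRel.arith (op : ℤ → ℤ → Option ℤ) (hv : ValRel n v₁ v₂) (hw : ValRel n w₁ w₂) :
    ResRel n (arith b op v₁ w₁) (arith b op v₂ w₂) := by
  have h := ResRel.badarith (b := b) (forall₂_pair hv hw)
  cases hv using ValRel.cases' <;> try exact h
  cases hw using ValRel.cases' <;> try exact h
  rename_i i j
  simp only [CoreErlang.arith]
  cases op i j with
  | none => exact h
  | some k => exact .ret (.int k)

theorem ResRel.arithUnary (op : ℤ → ℤ) (hv : ValRel n v₁ v₂) :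
    ResRel n (arithUnary b op v₁) (arithUnary b op v₂) := by
  have h := ResRel.badarith (b := b) (forall₂_single hv)
  cases hv using ValRel.cases' <;> try exact h
  exact .ret (.int _)

theorem ValRel.toBool_eq (hv : ValRel n v₁ v₂) : toBool v₁ = toBool v₂ := by
  cases hv using ValRel.cases' <;> rfl

theorem ValRel.toClass_eq (hv : ValRel n v₁ v₂) : toClass v₁ = toClass v₂ := by
  cases hv using ValRel.cases' <;> rfl

theorem ResRel.boolean (op : Bool → Bool → Bool) (hv : ValRel n v₁ v₂) (hw : ValRel n w₁ w₂) :
    ResRel n (boolean b op v₁ w₁) (boolean b op v₂ w₂) := by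
  rw [CoreErlang.boolean, CoreErlang.boolean, hv.toBool_eq, hw.toBool_eq]
  split
  · exact .retBool rfl
  · exact .badarg (forall₂_pair hv hw)

theorem ValRel.toList (hv : ValRel n v₁ v₂) :
    Option.Rel (List.Forall₂ (ValRel n)) v₁.toList v₂.toList := by
  induction hv using ValRel.induction with
  | cons _ _ _ _ h _ _ ih =>
    rw [Val.toList, Val.toList]
    exact optionRel_map ih fun _ _ => .cons h
  | nil => exact .some .nil
  | _ => exact .none

theorem ValRel.consList {vs ws : List Val} (h : List.Forall₂ (ValRel n) vs ws)
    (hv : ValRel n v₁ v₂) : ValRel n (consList vs v₁) (consList ws v₂) := by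
  induction h with
  | nil => exact hv
  | cons h _ ih => exact .cons h ih

theorem ValRel.removeFirst {vs ws : List Val} (hv : ValRel n v₁ v₂)
    (h : List.Forall₂ (ValRel n) vs ws) :
    List.Forall₂ (ValRel n) (removeFirst v₁ vs) (removeFirst v₂ ws) := by
  induction h with
  | nil => exact .nil
  | cons h h' ih =>
    rw [CoreErlang.removeFirst, CoreErlang.removeFirst, hv.cmp_eq h]
    split
    · exact h'
    · exact .cons h ih

theorem ValRel.foldl_removeFirst {vs ws vs' ws' : List Val} (h : List.Forall₂ (ValRel n) vs ws)
    (h' : List.Forall₂ (ValRel n) vs' ws') :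
    List.Forall₂ (ValRel n) (vs'.foldl (fun acc x => CoreErlang.removeFirst x acc) vs)
      (ws'.foldl (fun acc x => CoreErlang.removeFirst x acc) ws) := by
  induction h' generalizing vs ws with
  | nil => exact h
  | cons hv _ ih => exact ih (hv.removeFirst h)

theorem forall₂_getElem? {α β : Type*} {R : α → β → Prop} {l₁ : List α} {l₂ : List β}
    (h : List.Forall₂ R l₁ l₂) (i : ℕ) : Option.Rel R l₁[i]? l₂[i]? := by
  induction h generalizing i with
  | nil => exact .none
  | cons h _ ih =>
    cases i with
    | zero => exact .some h
    | succ i => simpa using ih i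

theorem forall₂_set {α β : Type*} {R : α → β → Prop} {l₁ : List α} {l₂ : List β}
    (h : List.Forall₂ R l₁ l₂) (i : ℕ) {a : α} {b : β} (hab : R a b) :
    List.Forall₂ R (l₁.set i a) (l₂.set i b) := by
  induction h generalizing i with
  | nil => exact .nil
  | cons h h' ih =>
    cases i with
    | zero => exact .cons hab h'
    | succ i => exact .cons h (ih i)

theorem ValRel.nth? {vs ws : List Val} (h : List.Forall₂ (ValRel n) vs ws) (i : ℤ) :
    Option.Rel (ValRel n) (nth? vs i) (nth? ws i) := by
  unfold CoreErlang.nth?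
  split
  · exact forall₂_getElem? h _
  · exact .none

theorem ResRel.evalBif {as bs : List Val} (h : List.Forall₂ (ValRel n) as bs) :
    ResRel n (evalBif b as) (evalBif b bs) := by
  have hu := ResRel.undef (m := aErlang) (f := b.name) h
  have hb := ResRel.badarg (b := b) h
  -- For each number of arguments, the functions that are not listed are undefined.
  rcases h with _ | ⟨hv, _ | ⟨hw, _ | ⟨hz, _ | ⟨hy, hl⟩⟩⟩⟩
  · cases b <;> exact hu
  · cases b
    case plus | minus => exact .arithUnary _ hv
    case abs =>
      cases hv using ValRel.cases' <;> first | exact hb | exact .ret (.int _)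
    case not =>
      simp only [CoreErlang.evalBif, hv.toBool_eq]
      cases toBool _
      · exact hb
      · exact .retBool rfl
    case length =>
      exact .elim hv.toList hb fun _ _ h => by rw [h.length_eq]; exact .ret (.int _)
    case hd | tl =>
      cases hv using ValRel.cases' <;> first | exact hb | exact .ret (by assumption)
    case tupleSize =>
      cases hv using ValRel.cases'
      case tuple h =>
        simp only [CoreErlang.evalBif, h.length_eq]
        exact .ret (.int _)
      all_goals exact hb
    case tupleToList =>
      cases hv using ValRel.cases'
      case tuple h => exact .ret (.consList h .nil)
      all_goals exact hb
    case listToTuple => exact .elim hv.toList hb fun _ _ h => .ret (.tuple h)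
    case isInteger | isNumber | isAtom | isFunction | isList | isTuple | isMap =>
      exact .retBool (by rw [hv.rank_eq])
    case isBoolean => exact .retBool (by rw [hv.toBool_eq])
    case error | exit | throw => exact .exc _ hv .noDetails
    all_goals first
      | exact hu
      | cases hv using ValRel.cases' <;> exact hu
  · cases b
    case plus | minus | times | div | rem | bsl | bsr => exact .arith _ hv hw
    case and | or | xor => exact .boolean _ hv hw
    case eq | exactEq | ne | exactNe | lt | le | gt | ge =>
      exact .retBool (by rw [hv.cmp_eq hw])
    case append => exact .elim hv.toList hb fun _ _ h => .ret (.consList h hw)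
    case subtract =>
      exact .elim hv.toList hb fun _ _ h => .elim hw.toList hb fun _ _ h' =>
        .ret (.consList (ValRel.foldl_removeFirst h h') .nil)
    case element =>
      cases hv using ValRel.cases' <;> try exact hb
      cases hw using ValRel.cases' <;> try exact hb
      rename_i h
      exact .elim (ValRel.nth? h _) hb fun _ _ h => .ret h
    case isFunction =>
      cases hw using ValRel.cases' <;> try exact hb
      simp only [CoreErlang.evalBif]
      split
      · cases hv using ValRel.cases' <;> try exact .retBool rfl
        rename_i h
        exact .retBool (by rw [h.2.2.1])
      · exact hb
    case funInfo =>
      cases hv using ValRel.cases' <;> try exact hb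
      cases hw using ValRel.cases' <;> try exact hb
      rename_i h _
      simp only [CoreErlang.evalBif]
      split
      · rw [h.2.2.1]
        exact .ret (.tuple (forall₂_pair (.atom _) (.int _)))
      · exact hb
    case error => exact .exc _ hv hw
    all_goals first
      | exact hu
      | cases hv using ValRel.cases' <;> exact hu
      | cases hv using ValRel.cases' <;> first
          | exact hu
          | cases hw using ValRel.cases' <;> exact hu
  · cases b
    case setelement =>
      cases hv using ValRel.cases' <;> try exact hb
      cases hw using ValRel.cases' <;> try exact hb
      rename_i h
      exact .elim (ValRel.nth? h _) hb fun _ _ _ => .ret (.tuple (forall₂_set h _ hz))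
    case raise =>
      simp only [CoreErlang.evalBif, hv.toClass_eq]
      cases toClass _
      · exact hb
      · exact .exc _ hw hz
    all_goals first
      | exact hu
      | cases hv using ValRel.cases' <;> exact hu
      | cases hv using ValRel.cases' <;> first
          | exact hu
          | cases hw using ValRel.cases' <;> exact hu
  · cases b
    all_goals first
      | exact hu
      | cases hv using ValRel.cases' <;> exact hu
      | cases hv using ValRel.cases' <;> first
          | exact hu
          | cases hw using ValRel.cases' <;> exact hu

end Bif

theorem ResRel.evalCall {n : ℕ} {m₁ m₂ f₁ f₂ : Val} {as bs : List Val} (hm : ValRel n m₁ m₂)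
    (hf : ValRel n f₁ f₂) (h : List.Forall₂ (ValRel n) as bs) :
    ResRel n (evalCall m₁ f₁ as) (evalCall m₂ f₂ bs) := by
  have hb := ResRel.err aBadarg (ValRel.tuple (forall₂_pair hm hf))
  cases hm using ValRel.cases' <;> try exact hb
  cases hf using ValRel.cases' <;> try exact hb
  rename_i m f
  simp only [CoreErlang.evalCall]
  cases bifTable m f with
  | none => exact .undef h
  | some b => exact .evalBif h

theorem ResRel.evalPrimop {n : ℕ} (a : Atom) {as bs : List Val}
    (h : List.Forall₂ (ValRel n) as bs) : ResRel n (evalPrimop a as) (evalPrimop a bs) := by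
  have hu := ResRel.err aUndef (ValRel.tuple (.cons (.atom a) h))
  rcases h with _ | ⟨hv, _ | _⟩
  · exact hu
  · simp only [CoreErlang.evalPrimop]
    split
    · exact .exc _ hv .noDetails
    · exact hu
  · exact hu

theorem PairRel.mapInsert {n : ℕ} {k₁ k₂ v₁ v₂ : Val} {l₁ l₂ : List (Val × Val)}
    (hk : ValRel n k₁ k₂) (hv : ValRel n v₁ v₂) (h : List.Forall₂ (PairRel n) l₁ l₂) :
    List.Forall₂ (PairRel n) (mapInsert k₁ v₁ l₁) (mapInsert k₂ v₂ l₂) := by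
  induction h with
  | nil => exact forall₂_single ⟨hk, hv⟩
  | cons h h' ih =>
    rw [CoreErlang.mapInsert, CoreErlang.mapInsert, hk.cmp_eq h.1]
    split
    · exact .cons ⟨hk, hv⟩ (.cons h h')
    · exact .cons ⟨hk, hv⟩ h'
    · exact .cons h ih

theorem PairRel.mkMap {n : ℕ} {l₁ l₂ : List (Val × Val)} (h : List.Forall₂ (PairRel n) l₁ l₂) :
    List.Forall₂ (PairRel n) (mkMap l₁) (mkMap l₂) := by
  refine List.rel_foldl (R := PairRel n) (P := List.Forall₂ (PairRel n)) ?_ .nil h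
  intro m₁ m₂ hm p q hp
  exact PairRel.mapInsert hp.1 hp.2 hm

theorem PairRel.pairUp {n : ℕ} : ∀ {vs ws : List Val}, List.Forall₂ (ValRel n) vs ws →
    Option.Rel (List.Forall₂ (PairRel n)) (pairUp vs) (pairUp ws)
  | _, _, .nil => .some .nil
  | _, _, .cons _ .nil => .none
  | _, _, .cons hk (.cons hv h) => by
    rw [CoreErlang.pairUp, CoreErlang.pairUp]
    exact optionRel_map (PairRel.pairUp h) fun _ _ => .cons ⟨hk, hv⟩

/-! ### Pattern matching on related values -/

/-- Related bindings of the same name. -/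
def BindRel (n : ℕ) (b c : Name × Val) : Prop := b.1 = c.1 ∧ ValRel n b.2 c.2

mutual

theorem BindRel.matchPat {n : ℕ} : ∀ (p : Pat) {v w : Val}, ValRel n v w →
    Option.Rel (List.Forall₂ (BindRel n)) (matchPat p v) (matchPat p w)
  | .var x, v, w, h => .some (forall₂_single ⟨rfl, h⟩)
  | .int i, v, w, h => by
    cases h using ValRel.cases' <;> try exact .none
    rw [CoreErlang.matchPat]
    split
    · exact .some .nil
    · exact .none
  | .atom a, v, w, h => by
    cases h using ValRel.cases' <;> try exact .none
    rw [CoreErlang.matchPat]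
    split
    · exact .some .nil
    · exact .none
  | .nil, v, w, h => by
    cases h using ValRel.cases' <;> try exact .none
    exact .some .nil
  | .cons p q, v, w, h => by
    cases h using ValRel.cases' <;> try exact .none
    rename_i hv hw
    rw [CoreErlang.matchPat, CoreErlang.matchPat]
    exact optionRel_bind (BindRel.matchPat p hv) fun _ _ h =>
      optionRel_map (BindRel.matchPat q hw) fun _ _ h' => List.rel_append h h'
  | .tuple ps, v, w, h => by
    cases h using ValRel.cases' <;> try exact .none
    rename_i h
    exact BindRel.matchPats ps h
  | .map ps, v, w, h => by
    cases h using ValRel.cases' <;> try exact .none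
    rename_i h
    exact BindRel.matchPairs ps h

theorem BindRel.matchPats {n : ℕ} : ∀ (ps : List Pat) {vs ws : List Val},
    List.Forall₂ (ValRel n) vs ws →
    Option.Rel (List.Forall₂ (BindRel n)) (matchPats ps vs) (matchPats ps ws)
  | [], _, _, .nil => .some .nil
  | [], _, _, .cons _ _ => .none
  | p :: ps, _, _, .nil => .none
  | p :: ps, _, _, .cons h h' => by
    rw [CoreErlang.matchPats, CoreErlang.matchPats]
    exact optionRel_bind (BindRel.matchPat p h) fun _ _ h =>
      optionRel_map (BindRel.matchPats ps h') fun _ _ h' => List.rel_append h h'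

theorem BindRel.matchPairs {n : ℕ} : ∀ (ps : List (Pat × Pat)) {vs ws : List (Val × Val)},
    List.Forall₂ (PairRel n) vs ws →
    Option.Rel (List.Forall₂ (BindRel n)) (matchPairs ps vs) (matchPairs ps ws)
  | [], _, _, .nil => .some .nil
  | [], _, _, .cons _ _ => .none
  | p :: ps, _, _, .nil => .none
  | (p, q) :: ps, _, _, .cons h h' => by
    rw [CoreErlang.matchPairs, CoreErlang.matchPairs]
    exact optionRel_bind (BindRel.matchPat p h.1) fun _ _ h₁ =>
      optionRel_bind (BindRel.matchPat q h.2) fun _ _ h₂ =>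
        optionRel_map (BindRel.matchPairs ps h') fun _ _ h₃ =>
          List.rel_append (List.rel_append h₁ h₂) h₃

end

mutual

theorem matchPat_names : ∀ (p : Pat) (v : Val) (l : List (Name × Val)), matchPat p v = some l →
    l.map Prod.fst = varNames p.vars
  | .var x, v, l, h => by
    simp only [matchPat, Option.some.injEq] at h
    simp [← h, Pat.vars, varNames]
  | .int i, v, l, h => by
    cases v <;> simp [matchPat] at h
    simp [← h.2, Pat.vars, varNames]
  | .atom i, v, l, h => by
    cases v <;> simp [matchPat] at h
    simp [← h.2, Pat.vars, varNames]
  | .nil, v, l, h => by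
    cases v <;> simp [matchPat] at h
    simp [h, Pat.vars, varNames]
  | .cons p q, v, l, h => by
    cases v <;> simp [matchPat, Option.bind_eq_some_iff] at h
    obtain ⟨l₁, h₁, l₂, h₂, rfl⟩ := h
    simp [matchPat_names p _ _ h₁, matchPat_names q _ _ h₂, Pat.vars, varNames]
  | .tuple ps, v, l, h => by
    cases v <;> simp [matchPat] at h
    simp [matchPats_names ps _ _ h, Pat.vars]
  | .map ps, v, l, h => by
    cases v <;> simp [matchPat] at h
    simp [matchPairs_names ps _ _ h, Pat.vars]

/-- A successful match binds exactly the variables of the patterns. -/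
theorem matchPats_names : ∀ (ps : List Pat) (vs : List Val) (l : List (Name × Val)),
    matchPats ps vs = some l → l.map Prod.fst = varNames (Pat.varsList ps)
  | [], [], l, h => by
    simp only [matchPats, Option.some.injEq] at h
    simp [← h, Pat.varsList, varNames]
  | [], _ :: _, l, h => by simp [matchPats] at h
  | _ :: _, [], l, h => by simp [matchPats] at h
  | p :: ps, v :: vs, l, h => by
    simp [matchPats, Option.bind_eq_some_iff] at h
    obtain ⟨l₁, h₁, l₂, h₂, rfl⟩ := h
    have := matchPats_names ps _ _ h₂
    simp_all [matchPat_names p _ _ h₁, Pat.varsList, varNames]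

theorem matchPairs_names : ∀ (ps : List (Pat × Pat)) (vs : List (Val × Val))
    (l : List (Name × Val)), matchPairs ps vs = some l →
    l.map Prod.fst = varNames (Pat.varsPairs ps)
  | [], [], l, h => by
    simp only [matchPairs, Option.some.injEq] at h
    simp [← h, Pat.varsPairs, varNames]
  | [], _ :: _, l, h => by simp [matchPairs] at h
  | _ :: _, [], l, h => by simp [matchPairs] at h
  | (p, q) :: ps, (v, w) :: vs, l, h => by
    simp [matchPairs, Option.bind_eq_some_iff] at h
    obtain ⟨l₁, h₁, l₂, h₂, l₃, h₃, rfl⟩ := h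
    have := matchPairs_names ps _ _ h₃
    simp_all [matchPat_names p _ _ h₁, matchPat_names q _ _ h₂, Pat.varsPairs, varNames]

end

/-! ### Termination -/

theorem Term.step {K K' : FrameStack} {r r' : Redex} (h : Step K r K' r') (ht : Term K' r') :
    Term K r := by
  obtain ⟨n, res, hres, hs⟩ := ht
  exact ⟨n + 1, res, hres, .step h hs⟩

/-- The length `n` of a run is either `0`, and the configuration is final, or there is a first
step. -/
theorem TermIn.cases_step {n : ℕ} {K : FrameStack} {r : Redex} (h : TermIn n K r) :
    (K = [] ∧ r.IsResult) ∨ ∃ m K' r', n = m + 1 ∧ Step K r K' r' ∧ TermIn m K' r' := by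
  obtain ⟨res, hres, hs⟩ := h
  cases hs with
  | refl => exact .inl ⟨rfl, hres⟩
  | step h hs => exact .inr ⟨_, _, _, rfl, h, _, hres, hs⟩

/-- A configuration that is not final terminates in `n` steps only by way of a step. -/
theorem TermIn.exists_step {n : ℕ} {K : FrameStack} {r : Redex} (h : TermIn n K r)
    (hK : K ≠ [] ∨ ¬ r.IsResult) :
    ∃ m K' r', n = m + 1 ∧ Step K r K' r' ∧ TermIn m K' r' := by
  rcases h.cases_step with ⟨h, h'⟩ | h
  · tauto
  · exact h

/-! ### Related redexes and frame stacks -/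

theorem RedexRel.term {m n : ℕ} {r₁ r₂ : Redex} {K₁ K₂ : FrameStack} (h : RedexRel n r₁ r₂)
    (hm : m ≤ n) (hK : StackRel m K₁ K₂) (ht : TermIn m K₁ r₁) : Term K₂ r₂ :=
  h.2.2 m hm K₁ K₂ hK ht

theorem RedexRel.box (n : ℕ) : RedexRel n .box .box :=
  ⟨trivial, trivial, fun m _ _ _ hK ht => hK.2.2.2.2 m le_rfl ht⟩

theorem ResRel.redexRel {n : ℕ} {r₁ r₂ : Redex} (h : ResRel n r₁ r₂) : RedexRel n r₁ r₂ := by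
  cases h with
  | vals h =>
    exact ⟨(ValRel.scopedList h).1, (ValRel.scopedList h).2, fun m hm _ _ hK ht =>
      hK.2.2.1 m le_rfl _ _ (ValRel.forall₂_mono hm h) ht⟩
  | @exc c v₁ v₂ w₁ w₂ hv hw =>
    exact ⟨⟨hv.scoped.1, hw.scoped.1⟩, ⟨hv.scoped.2, hw.scoped.2⟩, fun m hm _ _ hK ht =>
      hK.2.2.2.1 m le_rfl ⟨c, v₁, w₁⟩ ⟨c, v₂, w₂⟩ ⟨rfl, hv.mono hm, hw.mono hm⟩ ht⟩

/-- Expressions are related if their first steps can be simulated. -/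
theorem RedexRel.exp_of_step {n : ℕ} {e₁ e₂ : Exp} (h₁ : e₁.Scoped ∅) (h₂ : e₂.Scoped ∅)
    (h : ∀ m < n, ∀ K₁ K₂, StackRel m K₁ K₂ → ∀ K r, Step K₁ (.exp e₁) K r → TermIn m K r →
      Term K₂ (.exp e₂)) : RedexRel n (.exp e₁) (.exp e₂) := by
  refine ⟨h₁, h₂, fun m hm K₁ K₂ hK ht => ?_⟩
  obtain ⟨k, K, r, rfl, hs, ht⟩ := ht.exists_step (.inr (by simp [Redex.IsResult]))
  have hK : StackRel (k + 1) K₁ K₂ := hK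
  exact h k (by omega) _ _ (hK.mono (by omega)) _ _ hs ht

/-- A frame is simulated by another one if all steps at it are. -/
theorem StackRel.frame {n : ℕ} {F₁ F₂ : Frame} {K₁ K₂ : FrameStack} (h₁ : F₁.Closed)
    (h₂ : F₂.Closed) (hK : StackRel n K₁ K₂)
    (hv : ∀ m < n, ∀ vs₁ vs₂, List.Forall₂ (ValRel m) vs₁ vs₂ → ∀ K r,
      Step (F₁ :: K₁) (.vals vs₁) K r → TermIn m K r → Term (F₂ :: K₂) (.vals vs₂))
    (hx : ∀ m < n, ∀ c v₁ v₂ w₁ w₂, ValRel m v₁ v₂ → ValRel m w₁ w₂ → ∀ K r,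
      Step (F₁ :: K₁) (.exc ⟨c, v₁, w₁⟩) K r → TermIn m K r → Term (F₂ :: K₂) (.exc ⟨c, v₂, w₂⟩))
    (hb : ∀ m < n, ∀ K r, Step (F₁ :: K₁) .box K r → TermIn m K r → Term (F₂ :: K₂) .box) :
    StackRel n (F₁ :: K₁) (F₂ :: K₂) := by
  refine ⟨List.forall_mem_cons.2 ⟨h₁, hK.1⟩, List.forall_mem_cons.2 ⟨h₂, hK.2.1⟩, ?_, ?_, ?_⟩
  · intro m hm vs₁ vs₂ hvs ht
    obtain ⟨k, K, r, rfl, hs, ht⟩ := ht.exists_step (.inl (by simp))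
    exact hv k hm _ _ (ValRel.forall₂_mono (Nat.le_succ k) hvs) _ _ hs ht
  · rintro m hm ⟨c, v₁, w₁⟩ ⟨c', v₂, w₂⟩ ⟨hc, hv, hw⟩ ht
    obtain ⟨k, K, r, rfl, hs, ht⟩ := ht.exists_step (.inl (by simp))
    obtain rfl : c = c' := hc
    exact hx k hm _ _ _ _ _ (hv.mono (Nat.le_succ k)) (hw.mono (Nat.le_succ k)) _ _ hs ht
  · intro m hm ht
    obtain ⟨k, K, r, rfl, hs, ht⟩ := ht.exists_step (.inl (by simp))
    exact hb k hm _ _ hs ht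

/-- For frames that are not `try` frames, exceptions need no consideration: they remove the
frame. -/
theorem StackRel.frame_of_not_isTry {n : ℕ} {F₁ F₂ : Frame} {K₁ K₂ : FrameStack} (h₁ : F₁.Closed)
    (h₂ : F₂.Closed) (ht₁ : ¬ F₁.IsTry) (ht₂ : ¬ F₂.IsTry) (hK : StackRel n K₁ K₂)
    (hv : ∀ m < n, ∀ vs₁ vs₂, List.Forall₂ (ValRel m) vs₁ vs₂ → ∀ K r,
      Step (F₁ :: K₁) (.vals vs₁) K r → TermIn m K r → Term (F₂ :: K₂) (.vals vs₂))
    (hb : ∀ m < n, ∀ K r, Step (F₁ :: K₁) .box K r → TermIn m K r → Term (F₂ :: K₂) .box) :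
    StackRel n (F₁ :: K₁) (F₂ :: K₂) := by
  refine .frame h₁ h₂ hK hv ?_ hb
  intro m hm c v₁ v₂ w₁ w₂ hv hw K r hs ht
  cases hs with
  | excTry => exact (ht₁ trivial).elim
  | excProp =>
    exact .step (.excProp _ _ _ ht₂)
      (hK.2.2.2.1 m hm.le ⟨c, v₁, w₁⟩ ⟨c, v₂, w₂⟩ ⟨rfl, hv, hw⟩ ht)

theorem StackRel.nil (n : ℕ) : StackRel n [] [] := by
  refine ⟨by simp [StackClosed], by simp [StackClosed], ?_, ?_, ?_⟩
  · intro m _ vs₁ vs₂ _ _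
    exact ⟨0, .vals vs₂, trivial, .refl _ _⟩
  · intro m _ x₁ x₂ _ _
    exact ⟨0, .exc x₂, trivial, .refl _ _⟩
  · intro m _ ht
    obtain ⟨_, _, _, _, hs, _⟩ := ht.exists_step (.inr (by simp [Redex.IsResult]))
    cases hs

/-- Related expressions. -/
abbrev ExpRel (n : ℕ) (e₁ e₂ : Exp) : Prop := RedexRel n (.exp e₁) (.exp e₂)

/-- Expressions under a binder of the names `ns`, related under all related bindings. -/
def AbsRel (n : ℕ) (ns : List Name) (e₁ e₂ : Exp) : Prop :=
  e₁.Scoped (extend ∅ ns) ∧ e₂.Scoped (extend ∅ ns) ∧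
    ∀ m ≤ n, ∀ l₁ l₂, List.Forall₂ (BindRel m) l₁ l₂ → l₁.map Prod.fst = ns →
      ExpRel m (e₁.subst (Subst.ofList l₁)) (e₂.subst (Subst.ofList l₂))

theorem AbsRel.mono {m n : ℕ} (hmn : m ≤ n) {ns : List Name} {e₁ e₂ : Exp}
    (h : AbsRel n ns e₁ e₂) : AbsRel m ns e₁ e₂ :=
  ⟨h.1, h.2.1, fun k hk => h.2.2 k (hk.trans hmn)⟩

theorem BindRel.bindVars {n : ℕ} (xs : List Var) {vs₁ vs₂ : List Val}
    (h : List.Forall₂ (ValRel n) vs₁ vs₂) :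
    List.Forall₂ (BindRel n) (bindVars xs vs₁) (bindVars xs vs₂) := by
  induction h generalizing xs with
  | nil => simp [CoreErlang.bindVars]
  | cons h _ ih =>
    cases xs with
    | nil => simp [CoreErlang.bindVars, varNames]
    | cons x xs => exact .cons ⟨rfl, h⟩ (ih xs)

theorem bindVars_names {xs : List Var} {vs : List Val} (h : xs.length = vs.length) :
    (bindVars xs vs).map Prod.fst = varNames xs :=
  List.map_fst_zip (by simp [varNames, h])

theorem AbsRel.bindVars {n : ℕ} {xs : List Var} {e₁ e₂ : Exp} (h : AbsRel n (varNames xs) e₁ e₂)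
    {vs₁ vs₂ : List Val} (hl : xs.length = vs₁.length) (hvs : List.Forall₂ (ValRel n) vs₁ vs₂) :
    ExpRel n (e₁.subst (Subst.ofList (bindVars xs vs₁)))
      (e₂.subst (Subst.ofList (bindVars xs vs₂))) :=
  h.2.2 n le_rfl _ _ (BindRel.bindVars xs hvs) (bindVars_names hl)

/-- Related clauses. -/
def ClauseRel (n : ℕ) (c₁ c₂ : Clause) : Prop :=
  c₁.pats = c₂.pats ∧ AbsRel n (varNames (Pat.varsList c₁.pats)) c₁.guard c₂.guard ∧
    AbsRel n (varNames (Pat.varsList c₁.pats)) c₁.body c₂.body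

theorem ClauseRel.mono {m n : ℕ} (hmn : m ≤ n) {c₁ c₂ : Clause} (h : ClauseRel n c₁ c₂) :
    ClauseRel m c₁ c₂ :=
  ⟨h.1, h.2.1.mono hmn, h.2.2.mono hmn⟩

theorem ClauseRel.scopedList {n : ℕ} {cls₁ cls₂ : List Clause}
    (h : List.Forall₂ (ClauseRel n) cls₁ cls₂) :
    Clause.ScopedList ∅ cls₁ ∧ Clause.ScopedList ∅ cls₂ := by
  simp only [Clause.scopedList_iff]
  exact ⟨forall_left_of_forall₂ h fun _ _ h => ⟨h.2.1.1, h.2.2.1⟩,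
    forall_right_of_forall₂ h fun _ _ h => h.1 ▸ ⟨h.2.1.2.1, h.2.2.2.1⟩⟩

theorem ExpRel.scopedList {n : ℕ} {es₁ es₂ : List Exp} (h : List.Forall₂ (ExpRel n) es₁ es₂) :
    Exp.ScopedList ∅ es₁ ∧ Exp.ScopedList ∅ es₂ := by
  simp only [Exp.scopedList_iff]
  exact ⟨forall_left_of_forall₂ h fun _ _ h => h.1, forall_right_of_forall₂ h fun _ _ h => h.2.1⟩

theorem ExpRel.forall₂_mono {m n : ℕ} (hmn : m ≤ n) {es₁ es₂ : List Exp}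
    (h : List.Forall₂ (ExpRel n) es₁ es₂) : List.Forall₂ (ExpRel m) es₁ es₂ :=
  h.imp fun _ _ => RedexRel.mono hmn

theorem ClauseRel.forall₂_mono {m n : ℕ} (hmn : m ≤ n) {es₁ es₂ : List Clause}
    (h : List.Forall₂ (ClauseRel n) es₁ es₂) : List.Forall₂ (ClauseRel m) es₁ es₂ :=
  h.imp fun _ _ => ClauseRel.mono hmn

/-- Related identifiers of parameter list frames. -/
inductive IdRel (n : ℕ) : FrameId → FrameId → Prop
  | tuple : IdRel n .tuple .tuple
  | values : IdRel n .values .values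
  | call {m₁ m₂ f₁ f₂ : Val} (hm : ValRel n m₁ m₂) (hf : ValRel n f₁ f₂) :
      IdRel n (.call m₁ f₁) (.call m₂ f₂)
  | primop (a : Atom) : IdRel n (.primop a) (.primop a)
  | map : IdRel n .map .map
  | app {v₁ v₂ : Val} (h : ValRel n v₁ v₂) : IdRel n (.app v₁) (.app v₂)

theorem IdRel.mono {m n : ℕ} (hmn : m ≤ n) {i₁ i₂ : FrameId} (h : IdRel n i₁ i₂) :
    IdRel m i₁ i₂ := by
  cases h with
  | tuple => exact .tuple
  | values => exact .values
  | call hm hf => exact .call (hm.mono hmn) (hf.mono hmn)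
  | primop a => exact .primop a
  | map => exact .map
  | app h => exact .app (h.mono hmn)

theorem IdRel.closed {n : ℕ} {i₁ i₂ : FrameId} (h : IdRel n i₁ i₂) : i₁.Closed ∧ i₂.Closed := by
  cases h with
  | call hm hf => exact ⟨⟨hm.scoped.1, hf.scoped.1⟩, hm.scoped.2, hf.scoped.2⟩
  | app h => exact h.scoped
  | _ => exact ⟨trivial, trivial⟩

theorem IdRel.map_iff {n : ℕ} {i₁ i₂ : FrameId} (h : IdRel n i₁ i₂) :
    i₁ = .map ↔ i₂ = .map := by
  cases h <;> simp

/-- Evaluation of parameter lists preserves the relation. For applications this consumes one unit of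
the index of the applied closures. -/
theorem IdRel.eval {m n : ℕ} (hmn : m < n) {i₁ i₂ : FrameId} (h : IdRel n i₁ i₂)
    {vs₁ vs₂ : List Val} (hvs : List.Forall₂ (ValRel m) vs₁ vs₂) {r₁ : Redex}
    (hr : eval i₁ vs₁ = some r₁) : ∃ r₂, eval i₂ vs₂ = some r₂ ∧ RedexRel m r₁ r₂ := by
  cases h with
  | tuple => cases hr; exact ⟨_, rfl, (ResRel.ret (.tuple hvs)).redexRel⟩
  | values => cases hr; exact ⟨_, rfl, (ResRel.vals hvs).redexRel⟩
  | call hm hf =>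
    cases hr
    exact ⟨_, rfl, (ResRel.evalCall (hm.mono hmn.le) (hf.mono hmn.le) hvs).redexRel⟩
  | primop a => cases hr; exact ⟨_, rfl, (ResRel.evalPrimop a hvs).redexRel⟩
  | map =>
    simp only [CoreErlang.eval] at hr ⊢
    have h := PairRel.pairUp hvs
    revert h hr
    generalize CoreErlang.pairUp vs₁ = o₁, CoreErlang.pairUp vs₂ = o₂
    rintro hr (h | _)
    · cases hr
      exact ⟨_, rfl, (ResRel.ret (.map (PairRel.mkMap h))).redexRel⟩
    · cases hr
  | app h =>
    cases hr
    refine ⟨_, rfl, ?_⟩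
    have h' := h.mono hmn.le
    cases h using ValRel.cases'
    case clos h =>
      -- Both closures have the same arity, so both applications succeed or both are a `badarity`.
      simp only [evalApp, ← h.2.2.1, ← hvs.length_eq]
      split
      · rename_i hl
        exact h.2.2.2 m hmn _ _ hl.symm hvs
      · exact (ResRel.err _ h').redexRel
    all_goals exact (ResRel.err _ h').redexRel

/-! ### Compatibility of the frames -/

theorem ValRel.eq_atom {n : ℕ} {a : Atom} {v : Val} (h : ValRel n (.atom a) v) : v = .atom a := by
  rw [ValRel] at h
  cases h
  rfl

section Frames

variable {n : ℕ} {K₁ K₂ : FrameStack} {e₁ e₂ : Exp} {es₁ es₂ : List Exp} {v₁ v₂ : Val}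
  {vs₁ vs₂ : List Val}

theorem StackRel.consHead (hK : StackRel n K₁ K₂) (hv : ValRel n v₁ v₂) :
    StackRel n (.consHead v₁ :: K₁) (.consHead v₂ :: K₂) := by
  refine .frame_of_not_isTry hv.scoped.1 hv.scoped.2 id id hK ?_ (by rintro _ _ _ _ ⟨⟩)
  intro m hm vs₁ vs₂ hvs K r hs ht
  cases hs
  obtain _ | ⟨h, _ | _⟩ := hvs
  exact .step (.pCons _ _ _) (hK.2.2.1 m hm.le _ _ (forall₂_single (.cons h (hv.mono hm.le))) ht)

theorem StackRel.consTail (hK : StackRel n K₁ K₂) (he : ExpRel n e₁ e₂) :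
    StackRel n (.consTail e₁ :: K₁) (.consTail e₂ :: K₂) := by
  refine .frame_of_not_isTry he.1 he.2.1 id id hK ?_ (by rintro _ _ _ _ ⟨⟩)
  intro m hm vs₁ vs₂ hvs K r hs ht
  cases hs
  obtain _ | ⟨h, _ | _⟩ := hvs
  exact .step (.sConsHead _ _ _) (he.term hm.le ((hK.mono hm.le).consHead h) ht)

theorem StackRel.seq (hK : StackRel n K₁ K₂) (he : ExpRel n e₁ e₂) :
    StackRel n (.seq e₁ :: K₁) (.seq e₂ :: K₂) := by
  refine .frame_of_not_isTry he.1 he.2.1 id id hK ?_ (by rintro _ _ _ _ ⟨⟩)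
  intro m hm vs₁ vs₂ hvs K r hs ht
  cases hs
  obtain _ | ⟨h, _ | _⟩ := hvs
  exact .step (.pSeq _ _ _) (he.term hm.le (hK.mono hm.le) ht)

theorem StackRel.elet {xs : List Var} (hK : StackRel n K₁ K₂) (he : AbsRel n (varNames xs) e₁ e₂) :
    StackRel n (.elet xs e₁ :: K₁) (.elet xs e₂ :: K₂) := by
  refine .frame_of_not_isTry he.1 he.2.1 id id hK ?_ (by rintro _ _ _ _ ⟨⟩)
  intro m hm vs₁ vs₂ hvs K r hs ht
  cases hs with
  | pLet _ _ _ _ hl =>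
    exact .step (.pLet _ _ _ _ (hl.trans hvs.length_eq))
      (((he.mono hm.le).bindVars hl hvs).term le_rfl (hK.mono hm.le) ht)

theorem StackRel.etry {xs ys : List Var} {e₁' e₂' : Exp} (hK : StackRel n K₁ K₂)
    (he : AbsRel n (varNames xs) e₁ e₂) (he' : AbsRel n (varNames ys) e₁' e₂') :
    StackRel n (.etry xs e₁ ys e₁' :: K₁) (.etry xs e₂ ys e₂' :: K₂) := by
  refine .frame ⟨he.1, he'.1⟩ ⟨he.2.1, he'.2.1⟩ hK ?_ ?_ (by rintro _ _ _ _ ⟨⟩)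
  · intro m hm vs₁ vs₂ hvs K r hs ht
    cases hs with
    | pTry _ _ _ _ _ _ hl =>
      exact .step (.pTry _ _ _ _ _ _ (hl.trans hvs.length_eq))
        (((he.mono hm.le).bindVars hl hvs).term le_rfl (hK.mono hm.le) ht)
  · intro m hm c v₁ v₂ w₁ w₂ hv hw K r hs ht
    cases hs with
    | excTry =>
      exact .step (.excTry _ _ _ _ _ _ _ _ _ _)
        (((he'.mono hm.le).bindVars rfl (forall₂_triple (.atom _) hv hw)).term le_rfl
          (hK.mono hm.le) ht)
    | excProp _ _ _ h => exact (h trivial).elim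

/-- A parameter list frame is compatible; by induction on the expressions still to be evaluated. The
expressions are related at a fixed index `n`, while the index `m` of the stacks decreases with each
parameter. -/
theorem StackRel.params {i₁ i₂ : FrameId} (hes : List.Forall₂ (ExpRel n) es₁ es₂) {m : ℕ}
    (hmn : m ≤ n) (hK : StackRel m K₁ K₂) (hi : IdRel m i₁ i₂)
    (hvs : List.Forall₂ (ValRel m) vs₁ vs₂)
    (hodd : i₁ = FrameId.map → Odd (vs₁.length + es₁.length)) :
    StackRel m (.params i₁ vs₁ es₁ :: K₁) (.params i₂ vs₂ es₂ :: K₂) := by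
  induction hes generalizing m vs₁ vs₂ with
  | nil =>
    have hs := ValRel.scopedList hvs
    refine .frame_of_not_isTry ⟨hi.closed.1, hs.1, trivial, hodd⟩
      ⟨hi.closed.2, hs.2, trivial, fun h => ?_⟩ id id hK ?_ ?_
    · rw [← hvs.length_eq]
      exact hodd (hi.map_iff.2 h)
    · intro k hk us₁ us₂ hus K r hs ht
      cases hs with
      | pParams _ _ _ _ _ hr =>
        obtain _ | ⟨h, _ | _⟩ := hus
        obtain ⟨r₂, hr₂, hrel⟩ := hi.eval hk
          (List.rel_append (ValRel.forall₂_mono hk.le hvs) (forall₂_single h)) hr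
        exact .step (.pParams _ _ _ _ _ hr₂) (hrel.term le_rfl (hK.mono hk.le) ht)
    · intro k hk K r hs ht
      cases hs with
      | pParams₀ _ _ _ _ hne hr =>
        obtain ⟨r₂, hr₂, hrel⟩ := hi.eval hk (ValRel.forall₂_mono hk.le hvs) hr
        exact .step (.pParams₀ _ _ _ _ (mt hi.map_iff.2 hne) hr₂)
          (hrel.term le_rfl (hK.mono hk.le) ht)
  | cons he hes ih =>
    have hs := ValRel.scopedList hvs
    have hs' := ExpRel.scopedList (.cons he hes)
    refine .frame_of_not_isTry ⟨hi.closed.1, hs.1, hs'.1, hodd⟩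
      ⟨hi.closed.2, hs.2, hs'.2, fun h => ?_⟩ id id hK ?_ ?_
    · rw [← hvs.length_eq, ← (List.Forall₂.cons he hes).length_eq]
      exact hodd (hi.map_iff.2 h)
    · intro k hk us₁ us₂ hus K r hs ht
      cases hs with
      | sParams =>
        obtain _ | ⟨h, _ | _⟩ := hus
        refine .step (.sParams _ _ _ _ _ _) (he.term (hk.le.trans hmn) ?_ ht)
        refine ih (hk.le.trans hmn) (hK.mono hk.le) (hi.mono hk.le)
          (List.rel_append (ValRel.forall₂_mono hk.le hvs) (forall₂_single h)) fun h => ?_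
        simpa [add_assoc, add_comm 1] using hodd h
    · intro k hk K r hs ht
      cases hs with
      | sParams₀ _ _ _ _ hne =>
        obtain _ | _ := hvs
        refine .step (.sParams₀ _ _ _ _ (mt hi.map_iff.2 hne)) (he.term (hk.le.trans hmn) ?_ ht)
        exact ih (hk.le.trans hmn) (hK.mono hk.le) (hi.mono hk.le) .nil
          fun h => (hne h).elim

theorem StackRel.app (hK : StackRel n K₁ K₂) (hes : List.Forall₂ (ExpRel n) es₁ es₂) :
    StackRel n (.app es₁ :: K₁) (.app es₂ :: K₂) := by
  have hs := ExpRel.scopedList hes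
  refine .frame_of_not_isTry hs.1 hs.2 id id hK ?_ (by rintro _ _ _ _ ⟨⟩)
  intro m hm vs₁ vs₂ hvs K r hs ht
  cases hs
  obtain _ | ⟨h, _ | _⟩ := hvs
  exact .step (.sAppParam _ _ _) ((RedexRel.box m).term le_rfl
    (.params hes hm.le (hK.mono hm.le) (.app h) .nil (by simp)) ht)

theorem StackRel.callFun (hK : StackRel n K₁ K₂) (hv : ValRel n v₁ v₂)
    (hes : List.Forall₂ (ExpRel n) es₁ es₂) :
    StackRel n (.callFun v₁ es₁ :: K₁) (.callFun v₂ es₂ :: K₂) := by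
  have hs := ExpRel.scopedList hes
  refine .frame_of_not_isTry ⟨hv.scoped.1, hs.1⟩ ⟨hv.scoped.2, hs.2⟩ id id hK ?_
    (by rintro _ _ _ _ ⟨⟩)
  intro m hm vs₁ vs₂ hvs K r hs ht
  cases hs
  obtain _ | ⟨h, _ | _⟩ := hvs
  exact .step (.sCallParam _ _ _ _) ((RedexRel.box m).term le_rfl
    (.params hes hm.le (hK.mono hm.le) (.call (hv.mono hm.le) h) .nil (by simp)) ht)

theorem StackRel.callMod (hK : StackRel n K₁ K₂) (he : ExpRel n e₁ e₂)
    (hes : List.Forall₂ (ExpRel n) es₁ es₂) :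
    StackRel n (.callMod e₁ es₁ :: K₁) (.callMod e₂ es₂ :: K₂) := by
  have hs := ExpRel.scopedList hes
  refine .frame_of_not_isTry ⟨he.1, hs.1⟩ ⟨he.2.1, hs.2⟩ id id hK ?_ (by rintro _ _ _ _ ⟨⟩)
  intro m hm vs₁ vs₂ hvs K r hs ht
  cases hs
  obtain _ | ⟨h, _ | _⟩ := hvs
  exact .step (.sCallFun _ _ _ _)
    (he.term hm.le ((hK.mono hm.le).callFun h (ExpRel.forall₂_mono hm.le hes)) ht)

/-- A guard frame is compatible as soon as the `case` frame for the remaining clauses is. -/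
theorem StackRel.caseGuard {cls₁ cls₂ : List Clause} (ps : List Pat) (hK : StackRel n K₁ K₂)
    (hc : StackRel n (.case cls₁ :: K₁) (.case cls₂ :: K₂))
    (hvs : List.Forall₂ (ValRel n) vs₁ vs₂) (he : ExpRel n e₁ e₂) :
    StackRel n (.caseGuard vs₁ ps e₁ cls₁ :: K₁) (.caseGuard vs₂ ps e₂ cls₂ :: K₂) := by
  have hs := ValRel.scopedList hvs
  refine .frame_of_not_isTry ⟨hs.1, he.1, hc.1 _ List.mem_cons_self⟩
    ⟨hs.2, he.2.1, hc.2.1 _ List.mem_cons_self⟩ id id hK ?_ (by rintro _ _ _ _ ⟨⟩)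
  intro m hm us₁ us₂ hus K r hs ht
  cases hs with
  | sCaseFalse =>
    obtain _ | ⟨h, _ | _⟩ := hus
    -- A value related to an atom is that atom, so both guards fail or both succeed.
    obtain rfl := h.eq_atom
    exact .step (.sCaseFalse _ _ _ _ _)
      ((ResRel.vals (ValRel.forall₂_mono hm.le hvs)).redexRel.term le_rfl (hc.mono hm.le) ht)
  | pCaseTrue =>
    obtain _ | ⟨h, _ | _⟩ := hus
    obtain rfl := h.eq_atom
    exact .step (.pCaseTrue _ _ _ _ _) (he.term hm.le (hK.mono hm.le) ht)

/-- A `case` frame is compatible; by induction on the clauses, since a failing guard returns to the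
`case` frame for the remaining ones. -/
theorem StackRel.case {cls₁ cls₂ : List Clause} (hcls : List.Forall₂ (ClauseRel n) cls₁ cls₂)
    {m : ℕ} (hmn : m ≤ n) (hK : StackRel m K₁ K₂) :
    StackRel m (.case cls₁ :: K₁) (.case cls₂ :: K₂) := by
  induction hcls generalizing m with
  | nil =>
    refine .frame_of_not_isTry trivial trivial id id hK ?_ (by rintro _ _ _ _ ⟨⟩)
    intro k hk us₁ us₂ hus K r hs ht
    cases hs
    exact .step (.excCase _ _) ((ResRel.err _ .noDetails).redexRel.term le_rfl (hK.mono hk.le) ht)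
  | @cons c₁ c₂ _ _ h hcls ih =>
    have hcl := ClauseRel.scopedList (.cons h hcls)
    refine .frame_of_not_isTry hcl.1 hcl.2 id id hK ?_ (by rintro _ _ _ _ ⟨⟩)
    intro k hk us₁ us₂ hus K r hs ht
    clear hcl
    obtain ⟨ps, eg₁, eb₁⟩ := c₁
    obtain ⟨ps', eg₂, eb₂⟩ := c₂
    obtain ⟨hp, hg, hb⟩ := h
    obtain rfl : ps = ps' := hp
    have hkn := hk.le.trans hmn
    have hmatch := BindRel.matchPats ps hus
    cases hs with
    | sCaseFail _ _ _ _ _ _ hl =>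
      rw [hl] at hmatch
      have hl₂ : matchPats ps us₂ = none := by
        generalize matchPats ps us₂ = o at hmatch
        cases hmatch
        rfl
      exact .step (.sCaseFail _ _ _ _ _ _ hl₂)
        ((ResRel.vals hus).redexRel.term le_rfl (ih hkn (hK.mono hk.le)) ht)
    | sCaseSuccess _ _ _ _ _ _ l hl =>
      rw [hl] at hmatch
      obtain ⟨l₂, hl₂, hll⟩ : ∃ l₂, matchPats ps us₂ = some l₂ ∧
          List.Forall₂ (BindRel k) l l₂ := by
        generalize matchPats ps us₂ = o at hmatch
        cases hmatch with
        | some h => exact ⟨_, rfl, h⟩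
      have hn := matchPats_names _ _ _ hl
      refine .step (.sCaseSuccess _ _ _ _ _ _ _ hl₂)
        ((hg.2.2 k hkn _ _ hll hn).term le_rfl ?_ ht)
      exact (hK.mono hk.le).caseGuard ps (ih hkn (hK.mono hk.le)) hus (hb.2.2 k hkn _ _ hll hn)

end Frames

/-! ### Compatibility of the expressions -/

section Expressions

variable {n : ℕ} {e₁ e₂ e₁' e₂' : Exp} {es₁ es₂ : List Exp}

theorem ExpRel.val {v₁ v₂ : Val} (h : ValRel n v₁ v₂) : ExpRel n (.val v₁) (.val v₂) := by
  refine .exp_of_step h.scoped.1 h.scoped.2 fun m hm K₁ K₂ hK K r hs ht => ?_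
  cases hs
  exact .step (.pValue _ _) ((ResRel.ret (h.mono hm.le)).redexRel.term le_rfl hK ht)

theorem ExpRel.lam {xs₁ xs₂ : List Var} (h : ValRel n (.clos [] xs₁ e₁) (.clos [] xs₂ e₂)) :
    ExpRel n (.lam xs₁ e₁) (.lam xs₂ e₂) := by
  have h' := h.scoped
  simp only [Val.Scoped, namesOf, List.map_nil, extend_nil] at h'
  refine .exp_of_step h'.1.2 h'.2.2 fun m hm K₁ K₂ hK K r hs ht => ?_
  cases hs
  exact .step (.pFun _ _ _) ((ResRel.ret (h.mono hm.le)).redexRel.term le_rfl hK ht)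

theorem ExpRel.values (h : List.Forall₂ (ExpRel n) es₁ es₂) :
    ExpRel n (.values es₁) (.values es₂) := by
  have hs := ExpRel.scopedList h
  refine .exp_of_step hs.1 hs.2 fun m hm K₁ K₂ hK K r hs ht => ?_
  cases hs
  exact .step (.sVals _ _)
    ((RedexRel.box m).term le_rfl (.params h hm.le hK .values .nil (by simp)) ht)

theorem ExpRel.tuple (h : List.Forall₂ (ExpRel n) es₁ es₂) :
    ExpRel n (.tuple es₁) (.tuple es₂) := by
  have hs := ExpRel.scopedList h
  refine .exp_of_step hs.1 hs.2 fun m hm K₁ K₂ hK K r hs ht => ?_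
  cases hs
  exact .step (.sTuple _ _)
    ((RedexRel.box m).term le_rfl (.params h hm.le hK .tuple .nil (by simp)) ht)

theorem ExpRel.primop (a : Atom) (h : List.Forall₂ (ExpRel n) es₁ es₂) :
    ExpRel n (.primop a es₁) (.primop a es₂) := by
  have hs := ExpRel.scopedList h
  refine .exp_of_step hs.1 hs.2 fun m hm K₁ K₂ hK K r hs ht => ?_
  cases hs
  exact .step (.sPrimOp _ _ _)
    ((RedexRel.box m).term le_rfl (.params h hm.le hK (.primop a) .nil (by simp)) ht)

theorem ExpRel.cons (h : ExpRel n e₁ e₂) (h' : ExpRel n e₁' e₂') :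
    ExpRel n (.cons e₁ e₁') (.cons e₂ e₂') := by
  refine .exp_of_step ⟨h.1, h'.1⟩ ⟨h.2.1, h'.2.1⟩ fun m hm K₁ K₂ hK K r hs ht => ?_
  cases hs
  exact .step (.sConsTail _ _ _) (h'.term hm.le (hK.consTail (h.mono hm.le)) ht)

theorem ExpRel.seq (h : ExpRel n e₁ e₂) (h' : ExpRel n e₁' e₂') :
    ExpRel n (.seq e₁ e₁') (.seq e₂ e₂') := by
  refine .exp_of_step ⟨h.1, h'.1⟩ ⟨h.2.1, h'.2.1⟩ fun m hm K₁ K₂ hK K r hs ht => ?_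
  cases hs
  exact .step (.sSeq _ _ _) (h.term hm.le (hK.seq (h'.mono hm.le)) ht)

theorem ExpRel.app (h : ExpRel n e₁ e₂) (h' : List.Forall₂ (ExpRel n) es₁ es₂) :
    ExpRel n (.app e₁ es₁) (.app e₂ es₂) := by
  have hs := ExpRel.scopedList h'
  refine .exp_of_step ⟨h.1, hs.1⟩ ⟨h.2.1, hs.2⟩ fun m hm K₁ K₂ hK K r hs ht => ?_
  cases hs
  exact .step (.sApp _ _ _) (h.term hm.le (hK.app (ExpRel.forall₂_mono hm.le h')) ht)

theorem ExpRel.call (h : ExpRel n e₁ e₂) (h' : ExpRel n e₁' e₂')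
    (hes : List.Forall₂ (ExpRel n) es₁ es₂) :
    ExpRel n (.call e₁ e₁' es₁) (.call e₂ e₂' es₂) := by
  have hs := ExpRel.scopedList hes
  refine .exp_of_step ⟨h.1, h'.1, hs.1⟩ ⟨h.2.1, h'.2.1, hs.2⟩ fun m hm K₁ K₂ hK K r hs ht => ?_
  cases hs
  exact .step (.sCallMod _ _ _ _)
    (h.term hm.le (hK.callMod (h'.mono hm.le) (ExpRel.forall₂_mono hm.le hes)) ht)

theorem ExpRel.case {cls₁ cls₂ : List Clause} (h : ExpRel n e₁ e₂)
    (h' : List.Forall₂ (ClauseRel n) cls₁ cls₂) : ExpRel n (.case e₁ cls₁) (.case e₂ cls₂) := by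
  have hs := ClauseRel.scopedList h'
  refine .exp_of_step ⟨h.1, hs.1⟩ ⟨h.2.1, hs.2⟩ fun m hm K₁ K₂ hK K r hs ht => ?_
  cases hs
  exact .step (.sCase _ _ _) (h.term hm.le (.case h' hm.le hK) ht)

theorem ExpRel.elet {xs : List Var} (h : ExpRel n e₁ e₂) (h' : AbsRel n (varNames xs) e₁' e₂') :
    ExpRel n (.elet xs e₁ e₁') (.elet xs e₂ e₂') := by
  refine .exp_of_step ⟨h.1, h'.1⟩ ⟨h.2.1, h'.2.1⟩ fun m hm K₁ K₂ hK K r hs ht => ?_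
  cases hs
  exact .step (.sLet _ _ _ _) (h.term hm.le (hK.elet (h'.mono hm.le)) ht)

theorem ExpRel.etry {xs ys : List Var} {e₁'' e₂'' : Exp} (h : ExpRel n e₁ e₂)
    (h' : AbsRel n (varNames xs) e₁' e₂') (h'' : AbsRel n (varNames ys) e₁'' e₂'') :
    ExpRel n (.etry e₁ xs e₁' ys e₁'') (.etry e₂ xs e₂' ys e₂'') := by
  refine .exp_of_step ⟨h.1, h'.1, h''.1⟩ ⟨h.2.1, h'.2.1, h''.2.1⟩
    fun m hm K₁ K₂ hK K r hs ht => ?_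
  cases hs
  exact .step (.sTry _ _ _ _ _ _) (h.term hm.le (hK.etry (h'.mono hm.le) (h''.mono hm.le)) ht)

theorem ExpRel.letrec {ext₁ ext₂ : List ClosItem} (h₁ : (Exp.letrec ext₁ e₁).Scoped ∅)
    (h₂ : (Exp.letrec ext₂ e₂).Scoped ∅)
    (h : ExpRel n (e₁.subst (Subst.ofList (mkClosList ext₁)))
      (e₂.subst (Subst.ofList (mkClosList ext₂)))) :
    ExpRel n (.letrec ext₁ e₁) (.letrec ext₂ e₂) := by
  refine .exp_of_step h₁ h₂ fun m hm K₁ K₂ hK K r hs ht => ?_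
  cases hs
  exact .step (.pLetRec _ _ _) (h.term hm.le hK ht)

theorem length_flatten (es : List (Exp × Exp)) : (flatten es).length = 2 * es.length := by
  induction es with
  | nil => rfl
  | cons p es ih => simp only [flatten, List.length_cons, ih]; omega

theorem ExpRel.map {es₁ es₂ : List (Exp × Exp)}
    (h : List.Forall₂ (fun p q : Exp × Exp => ExpRel n p.1 q.1 ∧ ExpRel n p.2 q.2) es₁ es₂) :
    ExpRel n (.map es₁) (.map es₂) := by
  have hs : (Exp.map es₁).Scoped ∅ ∧ (Exp.map es₂).Scoped ∅ := by
    simp only [Exp.Scoped, Exp.scopedPairs_iff]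
    exact ⟨forall_left_of_forall₂ h fun _ _ h => ⟨h.1.1, h.2.1⟩,
      forall_right_of_forall₂ h fun _ _ h => ⟨h.1.2.1, h.2.2.1⟩⟩
  refine .exp_of_step hs.1 hs.2 fun m hm K₁ K₂ hK K r hs ht => ?_
  have hf : ∀ {es₁ es₂ : List (Exp × Exp)},
      List.Forall₂ (fun p q : Exp × Exp => ExpRel n p.1 q.1 ∧ ExpRel n p.2 q.2) es₁ es₂ →
      List.Forall₂ (ExpRel n) (flatten es₁) (flatten es₂) := by
    intro es₁ es₂ h
    induction h with
    | nil => exact .nil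
    | cons h _ ih => exact .cons h.1 (.cons h.2 ih)
  cases hs with
  | sMap _ ek ev es =>
    obtain _ | ⟨h, hes⟩ := h
    -- One key is under evaluation; an odd number of subexpressions remains in the frame.
    refine .step (.sMap _ _ _ _) (h.1.term hm.le
      (.params (.cons h.2 (hf hes)) hm.le hK .map .nil fun _ => ?_) ht)
    simp [length_flatten]
  | pMap₀ =>
    obtain _ | _ := h
    exact .step (.pMap₀ _) ((ResRel.ret (.map .nil)).redexRel.term le_rfl hK ht)

end Expressions

/-! ### Related substitutions -/

theorem SubstRel.mono {Γ : Set Name} {m n : ℕ} {σ₁ σ₂ : Subst} (hmn : m ≤ n)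
    (h : SubstRel Γ n σ₁ σ₂) : SubstRel Γ m σ₁ σ₂ := by
  refine ⟨h.1, h.2.1, fun x hx => ?_⟩
  obtain ⟨v₁, v₂, h₁, h₂, hv⟩ := h.2.2 x hx
  exact ⟨v₁, v₂, h₁, h₂, hv.mono hmn⟩

theorem Subst.Scoped.closed {Γ : Set Name} {σ : Subst} (h : σ.Scoped Γ ∅) : σ.Closed := by
  intro n w hw
  by_cases hn : n ∈ Γ
  · obtain ⟨v, hv, hs⟩ := h.1 n hn
    simp_all
  · simp [h.2 n hn] at hw

/-- The scoping conditions on related substitutions are automatic, as related values are closed. -/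
theorem SubstRel.of_forall {Γ : Set Name} {n : ℕ} {σ₁ σ₂ : Subst}
    (h : ∀ x ∈ Γ, ∃ v₁ v₂, σ₁ x = some v₁ ∧ σ₂ x = some v₂ ∧ ValRel n v₁ v₂)
    (h' : ∀ x ∉ Γ, σ₁ x = none ∧ σ₂ x = none) : SubstRel Γ n σ₁ σ₂ := by
  refine ⟨⟨fun x hx => ?_, fun x hx => (h' x hx).1⟩, ⟨fun x hx => ?_, fun x hx => (h' x hx).2⟩, h⟩
  · obtain ⟨v₁, v₂, h₁, h₂, hv⟩ := h x hx
    exact ⟨v₁, h₁, hv.scoped.1⟩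
  · obtain ⟨v₁, v₂, h₁, h₂, hv⟩ := h x hx
    exact ⟨v₂, h₂, hv.scoped.2⟩

theorem BindRel.lookup {n : ℕ} {l₁ l₂ : List (Name × Val)} (h : List.Forall₂ (BindRel n) l₁ l₂)
    (x : Name) : Option.Rel (ValRel n) (l₁.lookup x) (l₂.lookup x) := by
  induction h with
  | nil => exact .none
  | @cons b c _ _ h _ ih =>
    obtain ⟨y, v⟩ := b
    obtain ⟨z, w⟩ := c
    obtain ⟨rfl : y = z, h⟩ := h
    by_cases hx : x = y
    · subst hx
      simpa using Option.Rel.some h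
    · have : (x == y) = false := by simpa using hx
      simpa [List.lookup, this] using ih

theorem lookup_eq_none_iff_names {l : List (Name × Val)} {x : Name} :
    l.lookup x = none ↔ x ∉ l.map Prod.fst := by
  rw [List.lookup_eq_none_iff]
  simp only [List.mem_map, not_exists, not_and, bne_iff_ne]
  exact ⟨fun h p hp hx => h p hp hx.symm, fun h p hp hx => h p hp hx.symm⟩

/-- Below a binder, related substitutions are continued by related bindings. -/
theorem SubstRel.extend {Γ : Set Name} {n : ℕ} {σ₁ σ₂ : Subst} {l₁ l₂ : List (Name × Val)}
    {ns : List Name} (h : SubstRel Γ n σ₁ σ₂) (hl : List.Forall₂ (BindRel n) l₁ l₂)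
    (hns : ∀ x, x ∈ l₁.map Prod.fst ↔ x ∈ ns) :
    SubstRel (extend Γ ns) n ((σ₁.remove ns).orElse (Subst.ofList l₁))
      ((σ₂.remove ns).orElse (Subst.ofList l₂)) := by
  have hb := BindRel.lookup hl
  refine .of_forall (fun x hx => ?_) fun x hx => ?_
  · by_cases hm : x ∈ ns
    · have h₁ : l₁.lookup x ≠ none := by
        rw [Ne, lookup_eq_none_iff_names, not_not, hns]
        exact hm
      simp only [Subst.orElse, Subst.remove, hm, if_true, Option.none_or, Subst.ofList]
      have := hb x
      revert this h₁
      generalize l₁.lookup x = o₁, l₂.lookup x = o₂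
      rintro h₁ (hv | _)
      · exact ⟨_, _, rfl, rfl, hv⟩
      · exact (h₁ rfl).elim
    · obtain ⟨v₁, v₂, h₁, h₂, hv⟩ := h.2.2 x (hx.resolve_right hm)
      exact ⟨v₁, v₂, by simp [Subst.orElse, Subst.remove, hm, h₁],
        by simp [Subst.orElse, Subst.remove, hm, h₂], hv⟩
  · rw [mem_extend, not_or] at hx
    have h₁ : l₁.lookup x = none := by
      rw [lookup_eq_none_iff_names, hns]
      exact hx.2
    have h₂ : l₂.lookup x = none := by
      have := hb x
      rw [h₁] at this
      generalize l₂.lookup x = o₂ at this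
      cases this
      rfl
    simp [Subst.orElse, Subst.remove, hx.2, h.1.2 x hx.1, h.2.1.2 x hx.1, Subst.ofList, h₁, h₂]

theorem SubstRel.empty (n : ℕ) : SubstRel ∅ n (fun _ => none) (fun _ => none) :=
  .of_forall (fun _ hx => hx.elim) fun _ _ => ⟨rfl, rfl⟩

/-! ### The fundamental property -/

/-- Related closing substitutions turn `e` into related expressions. -/
def Compat (Γ : Set Name) (e : Exp) : Prop :=
  ∀ n σ₁ σ₂, SubstRel Γ n σ₁ σ₂ → ExpRel n (e.subst σ₁) (e.subst σ₂)

section Fundamental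

variable {Γ : Set Name} {n : ℕ} {σ₁ σ₂ : Subst}

theorem Compat.expRel_ofList {ns : List Name} {e : Exp} (he : Compat (extend Γ ns) e)
    (hσ : SubstRel Γ n σ₁ σ₂) {l₁ l₂ : List (Name × Val)} (hl : List.Forall₂ (BindRel n) l₁ l₂)
    (hns : ∀ x, x ∈ l₁.map Prod.fst ↔ x ∈ ns) :
    ExpRel n ((e.subst (σ₁.remove ns)).subst (Subst.ofList l₁))
      ((e.subst (σ₂.remove ns)).subst (Subst.ofList l₂)) := by
  rw [Exp.subst_subst (hσ.1.closed.remove ns), Exp.subst_subst (hσ.2.1.closed.remove ns)]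
  exact he _ _ _ (hσ.extend hl hns)

theorem Compat.absRel {ns : List Name} {e : Exp} (hs : e.Scoped (extend Γ ns))
    (he : Compat (extend Γ ns) e) (hσ : SubstRel Γ n σ₁ σ₂) :
    AbsRel n ns (e.subst (σ₁.remove ns)) (e.subst (σ₂.remove ns)) :=
  ⟨scoped_subst_aux.2 _ _ _ _ (hσ.1.mapsTo.remove ns) hs,
    scoped_subst_aux.2 _ _ _ _ (hσ.2.1.mapsTo.remove ns) hs,
    fun _ hm _ _ hl hns => he.expRel_ofList (hσ.mono hm) hl (by simp [hns])⟩

theorem mkClosList_eq_map (ext : List ClosItem) :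
    mkClosList ext = ext.map fun c => (c.name, .clos ext c.params c.body) :=
  List.map_congr_left fun c _ => by cases c; rfl

theorem mkClosList_names (ext : List ClosItem) : (mkClosList ext).map Prod.fst = namesOf ext := by
  simp [mkClosList_eq_map, namesOf, Function.comp_def]

theorem extend_extend (Γ : Set Name) (ns ms : List Name) :
    extend (extend Γ ns) ms = extend Γ (ms ++ ns) := by
  ext x
  simp only [mem_extend, List.mem_append]
  tauto

theorem Subst.remove_remove (σ : Subst) (ns ms : List Name) :
    (σ.remove ns).remove ms = σ.remove (ms ++ ns) := by
  funext x
  by_cases h₁ : x ∈ ms <;> by_cases h₂ : x ∈ ns <;> simp [Subst.remove, h₁, h₂]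

/-- The closures of a compatible function body are related, if the definitions they refer to are
related at smaller indices. -/
theorem Compat.valRel_clos {ext : List ClosItem} {xs : List Var} {e : Exp}
    (hs : (Val.clos ext xs e).Scoped Γ)
    (he : Compat (extend (extend Γ (namesOf ext)) (varNames xs)) e) (hσ : SubstRel Γ n σ₁ σ₂)
    (hext : ∀ m < n, List.Forall₂ (BindRel m)
      (mkClosList (ext.map (ClosItem.subst (σ₁.remove (namesOf ext)))))
      (mkClosList (ext.map (ClosItem.subst (σ₂.remove (namesOf ext)))))) :
    ValRel n ((Val.clos ext xs e).subst σ₁) ((Val.clos ext xs e).subst σ₂) := by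
  have h₁ := hs.subst hσ.1
  have h₂ := hs.subst hσ.2.1
  simp only [Val.subst, ClosItem.substList_eq_map] at h₁ h₂ ⊢
  refine .clos ⟨h₁, h₂, rfl, fun m hm vs₁ vs₂ hl hvs => ?_⟩
  simp only [Subst.remove_remove, extend_extend] at he ⊢
  refine he.expRel_ofList (hσ.mono hm.le)
    (List.rel_append (BindRel.bindVars xs hvs) (hext m hm)) fun x => ?_
  simp [-List.mem_map, bindVars_names hl.symm, mkClosList_names]

/-- By induction on the index, recursive definitions with compatible bodies give related
bindings. -/
theorem Compat.bindRel_mkClosList {ext : List ClosItem}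
    (hs : ClosItem.ScopedList (CoreErlang.extend Γ (namesOf ext)) ext)
    (h : ∀ c ∈ ext, Compat (extend (extend Γ (namesOf ext)) (varNames c.params)) c.body)
    (hσ : SubstRel Γ n σ₁ σ₂) :
    List.Forall₂ (BindRel n) (mkClosList (ext.map (ClosItem.subst (σ₁.remove (namesOf ext)))))
      (mkClosList (ext.map (ClosItem.subst (σ₂.remove (namesOf ext))))) := by
  induction n using Nat.strong_induction_on with
  | _ n ih =>
    have hc : ∀ c ∈ ext, ValRel n ((Val.clos ext c.params c.body).subst σ₁)
        ((Val.clos ext c.params c.body).subst σ₂) := fun c hc =>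
      (h c hc).valRel_clos ⟨hs, ClosItem.scopedList_iff.1 hs c hc⟩ hσ
        fun m hm => ih m hm (hσ.mono hm.le)
    simp only [Val.subst, ClosItem.substList_eq_map] at hc
    simp only [mkClosList_eq_map, List.map_map, List.forall₂_map_left_iff,
      List.forall₂_map_right_iff, List.forall₂_same]
    exact fun c hm => ⟨by simp, by simpa using hc c hm⟩

theorem ExpRel.substList {es : List Exp} (h : ∀ e ∈ es, ExpRel n (e.subst σ₁) (e.subst σ₂)) :
    List.Forall₂ (ExpRel n) (Exp.substList σ₁ es) (Exp.substList σ₂ es) := by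
  simpa only [Exp.substList_eq_map, List.forall₂_map_left_iff, List.forall₂_map_right_iff,
    List.forall₂_same] using h

theorem ClauseRel.substList {cls : List Clause} (hs : Clause.ScopedList Γ cls)
    (h : ∀ c ∈ cls, ∀ Γ, (c.guard.Scoped Γ → Compat Γ c.guard) ∧
      (c.body.Scoped Γ → Compat Γ c.body))
    (hσ : SubstRel Γ n σ₁ σ₂) :
    List.Forall₂ (ClauseRel n) (Clause.substList σ₁ cls) (Clause.substList σ₂ cls) := by
  rw [Clause.scopedList_iff] at hs
  simp only [Clause.substList_eq_map, List.forall₂_map_left_iff, List.forall₂_map_right_iff,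
    List.forall₂_same]
  intro c hc
  refine ⟨by simp, ?_, ?_⟩
  · simpa using ((h c hc _).1 (hs c hc).1).absRel (hs c hc).1 hσ
  · simpa using ((h c hc _).2 (hs c hc).2).absRel (hs c hc).2 hσ

/-- The fundamental property: every value and every expression is related to itself under related
closing substitutions. -/
theorem fundamental :
    (∀ v : Val, ∀ Γ, v.Scoped Γ → ∀ n σ₁ σ₂, SubstRel Γ n σ₁ σ₂ →
      ValRel n (v.subst σ₁) (v.subst σ₂)) ∧
    ∀ e : Exp, ∀ Γ, e.Scoped Γ → Compat Γ e := by
  apply syntax_induction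
  case int => exact fun i Γ _ n σ₁ σ₂ _ => .int i
  case atom => exact fun a Γ _ n σ₁ σ₂ _ => .atom a
  case var | fid =>
    intros
    rename_i σ₁ σ₂ hσ
    obtain ⟨v₁, v₂, h₁, h₂, hv⟩ := hσ.2.2 _ ‹_›
    simpa [Val.subst, h₁, h₂] using hv
  case clos =>
    intro ext xs e ihc ih Γ hs n σ₁ σ₂ hσ
    exact (ih _ hs.2).valRel_clos hs hσ fun m hm => Compat.bindRel_mkClosList hs.1
      (fun c hc => ihc c hc _ (ClosItem.scopedList_iff.1 hs.1 c hc)) (hσ.mono hm.le)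
  case vcons =>
    intro v w ihv ihw Γ hs n σ₁ σ₂ hσ
    exact .cons (ihv _ hs.1 _ _ _ hσ) (ihw _ hs.2 _ _ _ hσ)
  case nil => exact fun Γ _ n σ₁ σ₂ _ => .nil
  case vtuple =>
    intro vs ih Γ hs n σ₁ σ₂ hσ
    simp only [Val.Scoped, Val.scopedList_iff] at hs
    simp only [Val.subst, Val.substList_eq_map]
    refine .tuple ?_
    simp only [List.forall₂_map_left_iff, List.forall₂_map_right_iff, List.forall₂_same]
    exact fun v hv => ih v hv _ (hs v hv) _ _ _ hσ
  case vmap =>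
    intro vs ih Γ hs n σ₁ σ₂ hσ
    simp only [Val.Scoped, Val.scopedPairs_iff] at hs
    simp only [Val.subst, Val.substPairs_eq_map]
    refine .map ?_
    simp only [List.forall₂_map_left_iff, List.forall₂_map_right_iff, List.forall₂_same]
    exact fun p hp => ⟨(ih p hp).1 _ (hs p hp).1 _ _ _ hσ, (ih p hp).2 _ (hs p hp).2 _ _ _ hσ⟩
  case val => exact fun v ih Γ hs n σ₁ σ₂ hσ => .val (ih _ hs _ _ _ hσ)
  case lam =>
    intro xs e ih Γ hs n σ₁ σ₂ hσ
    -- A function evaluates to a closure without recursive definitions.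
    have he := ih _ hs
    rw [← extend_nil Γ] at he
    have hs' : (Val.clos [] xs e).Scoped Γ := by
      simpa [Val.Scoped, Exp.Scoped, namesOf, extend_nil, ClosItem.ScopedList] using hs
    have := Compat.valRel_clos (ext := []) hs' he hσ fun m _ => .nil
    simp only [Val.subst, ClosItem.substList, namesOf, List.map_nil, Subst.remove_nil] at this
    exact .lam this
  case values =>
    intro es ih Γ hs n σ₁ σ₂ hσ
    rw [Exp.Scoped, Exp.scopedList_iff] at hs
    exact .values (ExpRel.substList fun e he => ih e he _ (hs e he) _ _ _ hσ)
  case cons =>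
    exact fun e₁ e₂ ih₁ ih₂ Γ hs n σ₁ σ₂ hσ =>
      .cons (ih₁ _ hs.1 _ _ _ hσ) (ih₂ _ hs.2 _ _ _ hσ)
  case tuple =>
    intro es ih Γ hs n σ₁ σ₂ hσ
    rw [Exp.Scoped, Exp.scopedList_iff] at hs
    exact .tuple (ExpRel.substList fun e he => ih e he _ (hs e he) _ _ _ hσ)
  case map =>
    intro es ih Γ hs n σ₁ σ₂ hσ
    rw [Exp.Scoped, Exp.scopedPairs_iff] at hs
    simp only [Exp.subst, Exp.substPairs_eq_map]
    refine .map ?_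
    simp only [List.forall₂_map_left_iff, List.forall₂_map_right_iff, List.forall₂_same]
    exact fun p hp => ⟨(ih p hp).1 _ (hs p hp).1 _ _ _ hσ, (ih p hp).2 _ (hs p hp).2 _ _ _ hσ⟩
  case call =>
    intro em ef es ihm ihf ih Γ hs n σ₁ σ₂ hσ
    rw [Exp.Scoped, Exp.scopedList_iff] at hs
    exact .call (ihm _ hs.1 _ _ _ hσ) (ihf _ hs.2.1 _ _ _ hσ)
      (ExpRel.substList fun e he => ih e he _ (hs.2.2 e he) _ _ _ hσ)
  case primop =>
    intro a es ih Γ hs n σ₁ σ₂ hσ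
    rw [Exp.Scoped, Exp.scopedList_iff] at hs
    exact .primop a (ExpRel.substList fun e he => ih e he _ (hs e he) _ _ _ hσ)
  case app =>
    intro e es ihe ih Γ hs n σ₁ σ₂ hσ
    rw [Exp.Scoped, Exp.scopedList_iff] at hs
    exact .app (ihe _ hs.1 _ _ _ hσ)
      (ExpRel.substList fun e he => ih e he _ (hs.2 e he) _ _ _ hσ)
  case case =>
    intro e cls ihe ih Γ hs n σ₁ σ₂ hσ
    exact .case (ihe _ hs.1 _ _ _ hσ)
      (ClauseRel.substList hs.2 (fun c hc Γ => ⟨(ih c hc).1 Γ, (ih c hc).2 Γ⟩) hσ)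
  case elet =>
    exact fun xs e₁ e₂ ih₁ ih₂ Γ hs n σ₁ σ₂ hσ =>
      .elet (ih₁ _ hs.1 _ _ _ hσ) ((ih₂ _ hs.2).absRel hs.2 hσ)
  case seq =>
    exact fun e₁ e₂ ih₁ ih₂ Γ hs n σ₁ σ₂ hσ =>
      .seq (ih₁ _ hs.1 _ _ _ hσ) (ih₂ _ hs.2 _ _ _ hσ)
  case letrec =>
    intro ext e ihc ih Γ hs n σ₁ σ₂ hσ
    have h₁ := hs.subst hσ.1
    have h₂ := hs.subst hσ.2.1
    simp only [Exp.subst, ClosItem.substList_eq_map] at h₁ h₂ ⊢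
    exact .letrec h₁ h₂ ((ih _ hs.2).expRel_ofList hσ
      (Compat.bindRel_mkClosList hs.1 (fun c hc => ihc c hc _ (ClosItem.scopedList_iff.1 hs.1 c hc))
        hσ) fun x => by simp [-List.mem_map, mkClosList_names])
  case etry =>
    exact fun e₁ xs e₂ ys e₃ ih₁ ih₂ ih₃ Γ hs n σ₁ σ₂ hσ =>
      .etry (ih₁ _ hs.1 _ _ _ hσ) ((ih₂ _ hs.2.1).absRel hs.2.1 hσ)
        ((ih₃ _ hs.2.2).absRel hs.2.2 hσ)

theorem Redex.Scoped.redexRel {r : Redex} (hr : r.Scoped Γ) (hσ : SubstRel Γ n σ₁ σ₂) :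
    RedexRel n (r.subst σ₁) (r.subst σ₂) := by
  cases r with
  | vals vs =>
    rw [Redex.Scoped, Val.scopedList_iff] at hr
    refine (ResRel.vals ?_).redexRel
    simp only [Val.substList_eq_map, List.forall₂_map_left_iff, List.forall₂_map_right_iff,
      List.forall₂_same]
    exact fun v hv => fundamental.1 v Γ (hr v hv) _ _ _ hσ
  | exc x =>
    exact (ResRel.exc _ (fundamental.1 _ _ hr.1 _ _ _ hσ)
      (fundamental.1 _ _ hr.2 _ _ _ hσ)).redexRel
  | exp e => exact fundamental.2 e Γ hr _ _ _ hσ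
  | box => exact .box n

end Fundamental

/-! ### Reflexivity on closed objects -/

theorem Val.Scoped.valRel_self {v : Val} (hv : v.Scoped ∅) (n : ℕ) : ValRel n v v := by
  have := fundamental.1 v ∅ hv _ _ _ (.empty n)
  rwa [hv.subst_eq_self] at this

theorem Exp.Scoped.expRel_self {e : Exp} (he : e.Scoped ∅) (n : ℕ) : ExpRel n e e := by
  have := fundamental.2 e ∅ he _ _ _ (.empty n)
  rwa [he.subst_eq_self] at this

/-- An expression below a binder is compared with itself by applying the fundamental property to the
bindings alone, which continue the empty substitution. -/
theorem Exp.Scoped.absRel_self {e : Exp} {ns : List Name} (he : e.Scoped (extend ∅ ns)) (n : ℕ) :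
    AbsRel n ns e e := by
  have h := (fundamental.2 e _ he).absRel he (.empty n)
  have hs : e.subst (Subst.remove (fun _ => none) ns) = e :=
    subst_eq_self_aux.2 e _ _ (fun x _ => by simp [Subst.remove]) he
  rwa [hs] at h

theorem Clause.ScopedList.clauseRel_self {cls : List Clause} (h : Clause.ScopedList ∅ cls) (n : ℕ) :
    List.Forall₂ (ClauseRel n) cls cls := by
  rw [Clause.scopedList_iff] at h
  exact List.forall₂_same.2 fun c hc => ⟨rfl, (h c hc).1.absRel_self n, (h c hc).2.absRel_self n⟩

theorem Exp.ScopedList.expRel_self {es : List Exp} (h : Exp.ScopedList ∅ es) (n : ℕ) :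
    List.Forall₂ (ExpRel n) es es :=
  List.forall₂_same.2 fun e he => (Exp.scopedList_iff.1 h e he).expRel_self n

theorem Val.ScopedList.valRel_self {vs : List Val} (h : Val.ScopedList ∅ vs) (n : ℕ) :
    List.Forall₂ (ValRel n) vs vs :=
  List.forall₂_same.2 fun v hv => (Val.scopedList_iff.1 h v hv).valRel_self n

theorem FrameId.Closed.idRel_self {i : FrameId} (h : i.Closed) (n : ℕ) : IdRel n i i := by
  cases i with
  | tuple => exact .tuple
  | values => exact .values
  | call vm vf => exact .call (h.1.valRel_self n) (h.2.valRel_self n)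
  | primop a => exact .primop a
  | map => exact .map
  | app vf => exact .app (Val.Scoped.valRel_self h n)

/-- A closed frame stack is related to itself. -/
theorem StackClosed.stackRel_self {K : FrameStack} (h : StackClosed K) (n : ℕ) :
    StackRel n K K := by
  induction K with
  | nil => exact .nil n
  | cons F K ih =>
    have hF : F.Closed := h F List.mem_cons_self
    have hK := ih fun F hF => h F (List.mem_cons_of_mem _ hF)
    cases F with
    | params id vs es =>
      exact .params (hF.2.2.1.expRel_self n) le_rfl hK (hF.1.idRel_self n) (hF.2.1.valRel_self n)
        hF.2.2.2
    | consTail e₁ => exact hK.consTail (Exp.Scoped.expRel_self hF n)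
    | consHead v₂ => exact hK.consHead (Val.Scoped.valRel_self hF n)
    | callMod ef es => exact hK.callMod (hF.1.expRel_self n) (hF.2.expRel_self n)
    | callFun vm es => exact hK.callFun (hF.1.valRel_self n) (hF.2.expRel_self n)
    | app es => exact hK.app (Exp.ScopedList.expRel_self hF n)
    | case cls => exact .case (Clause.ScopedList.clauseRel_self hF n) le_rfl hK
    | caseGuard vs ps eb cls =>
      exact hK.caseGuard ps (.case (hF.2.2.clauseRel_self n) le_rfl hK) (hF.1.valRel_self n)
        (hF.2.1.expRel_self n)
    | elet xs e₂ => exact hK.elet (Exp.Scoped.absRel_self hF n)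
    | seq e₂ => exact hK.seq (Exp.Scoped.expRel_self hF n)
    | etry xs e₂ ys e₃ => exact hK.etry (hF.1.absRel_self n) (hF.2.absRel_self n)

theorem Subst.Scoped.substRel_self {Γ : Set Name} {σ : Subst} (h : σ.Scoped Γ ∅) (n : ℕ) :
    SubstRel Γ n σ σ := by
  refine ⟨h, h, fun x hx => ?_⟩
  obtain ⟨v, hv, hs⟩ := h.1 x hx
  exact ⟨v, v, hv, hv, hs.valRel_self n⟩

end CoreErlang

theorem mainTheorem3 (r₁ r₂ : CoreErlang.Redex) (Γ : Set CoreErlang.Name) :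
    CoreErlang.CIUOpen Γ r₁ r₂ ↔ CoreErlang.RedexRelOpen Γ r₁ r₂ := by
  constructor
  · intro h n σ₁ σ₂ hσ
    have hciu := h σ₂ hσ.2.1
    -- The redex `r₁` is related to itself; the CIU preorder takes over on the right-hand side.
    have hrel := (CoreErlang.Redex.scoped_of_subst hσ.2.1.2 hciu.1).redexRel hσ
    exact ⟨hrel.1, hciu.2.1, fun m hm K₁ K₂ hK ht =>
      hciu.2.2 K₂ ⟨hK.2.1, hrel.term hm hK ht⟩⟩
  · intro h σ hσ
    have hrel := fun n => h n σ σ (hσ.substRel_self n)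
    exact ⟨(hrel 0).1, (hrel 0).2.1, fun K hK =>
      hK.2.elim fun n ht => (hrel n).term le_rfl (hK.1.stackRel_self n) ht⟩
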